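/- **Setting.** There are $N$ items, of which an unknown set $S$ with $|S|\le K$ is defective. A (non-adaptive) design with $M$ tests is an $M\times N$ binary matrix $A$. The true result of test $i$ is $1$ iff $A_{ij}=1$ for some $j\in S$. A *$\rho$-false-positive channel* reports every true result $1$ as $1$ and, independently for the different tests, reports a true result $0$ as $1$ with probability $\rho$ and as $0$ with probability $1-\rho$. A *probabilistic group testing scheme* consists of a random matrix $A$, independent of $S$ and of the noise, and a decoder that reads $N$, $K$, $A$ and the reported results $y$ and outputs a set $\widehat S$ of items. It *fails with probability at most $p$* if, for every $S$ with $|S|\le K$, $\mathbb P(\widehat S\ne S)\le p$, the probability being over $A$ and the noise. The *decoding complexity* is the number of steps of the decoder, which is one program for a random access machine with words of $O(\log N)$ bits, not depending on $N$ and $K$; each of the following takes one step: arithmetic on words ($+,-,\times$, integer division), comparison with a conditional jump, a memory access, reading a test result, reading an entry of $A$ or a position (or the length) of the list of tests containing a given item or of the list of items in a given test, and outputting a word. Here $\log$ is the natural logarithm. **Theorem ($\rho$-FPC NEON).** Let $C,\eta>0$ and let $b$ be a positive integer. There is a constant $D>0$, depending only on $C,\eta,b$, such that the following holds for all $0\le\rho\le1$,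 $\zeta>0$ and $0<\varepsilon<\tfrac14$ with $$\zeta\,\bigl(\log(2-4\varepsilon)\bigr)^2\ \ge\ \zeta\rho-\rho+1 .$$ There are a decoder program, a word-length constant and a constant $B$, depending only on $C,\eta,b,\rho,\zeta,\varepsilon$, such that for every sequence of positive integers $K=K(N)$ with $K=o\bigl(N^{1-2(1+\eta)/C}\bigr)$ as $N\to\infty$, and all sufficiently large $N$, this decoder together with a suitable random test matrix with $\lfloor Ce^{b+2}\zeta K\log N\rfloor$ tests is a non-adaptive probabilistic group testing scheme for the $\rho$-false-positive channel which recovers the defective set exactly, whose decoder always halts within $D\varepsilon^{-2}K\log N$ steps, and which fails with probability at most $B\,(K^{-b}+N^{-\eta})$. -/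

import Mathlib

open Filter Asymptotics

namespace GroupTesting

/-! ### Group testing and the false positive channel -/

/-- A test matrix with `M` tests and `N` items: `A i j = true` iff item `j` is in the pool of
test `i`. -/
abbrev TestMatrix (M N : ℕ) : Type := Matrix (Fin M) (Fin N) Bool

/-- The noiseless result of test `i` for the defective set `S`: the disjunction over all items `j`
of `A i j ∧ (j ∈ S)`. -/
def trueResult {M N : ℕ} (A : TestMatrix M N) (S : Finset (Fin N)) (i : Fin M) : Bool :=
  decide (∃ j, A i j = true ∧ j ∈ S)

/-- Transition probability of one use of the `ρ`-false-positive channel: a positive result is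
always reported positive, a negative result is reported positive with probability `ρ`. -/
def fpcBit (ρ : ℝ) : Bool → Bool → ℝ
  | true, true => 1
  | true, false => 0
  | false, true => ρ
  | false, false => 1 - ρ

/-- Probability that the channel turns the true results `v` of `M` tests into the observed results
`y`; the tests are corrupted independently of each other. -/
def fpcProb (ρ : ℝ) {M : ℕ} (v y : Fin M → Bool) : ℝ := ∏ i, fpcBit ρ (v i) (y i)

/-! ### The machine on which the decoder runs

A random access machine with finitely many registers in use and a read-write memory that is
initially zero.  All registers and memory cells hold `w`-bit words, and addresses are words.  The
number of items `N`, the bound `K`, the number of tests `M`, the observed results and the test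
matrix are given; the matrix is stored by entries and by its column lists and row lists of
nonzero positions (increasing, positions counted from zero).  Every instruction takes one step. -/

/-- The instructions.  Arguments are register numbers, except `v` in `const` (a constant) and
`t` in `jumpLT` (a position in the program).  The first argument `d` is the register that receives
the result. -/
inductive Instr : Type
  /-- `d := v` -/
  | const (d v : ℕ)
  /-- `d := a + b` -/
  | add (d a b : ℕ)
  /-- `d := a - b`, or `0` if `a < b` -/
  | sub (d a b : ℕ)
  /-- `d := a * b` -/
  | mul (d a b : ℕ)
  /-- `d := a / b` rounded down, `0` if `b = 0` -/
  | div (d a b : ℕ)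
  /-- `d :=` the memory cell with address `a` -/
  | load (d a : ℕ)
  /-- the memory cell with address `a` becomes `b` -/
  | store (a b : ℕ)
  /-- `d :=` the observed result of test `a` -/
  | outcome (d a : ℕ)
  /-- `d :=` the entry of the test matrix at test `a`, item `b` -/
  | entry (d a b : ℕ)
  /-- `d :=` the number of tests that contain item `a` -/
  | colLen (d a : ℕ)
  /-- `d :=` the test at position `b` in the list of the tests that contain item `a` -/
  | colGet (d a b : ℕ)
  /-- `d :=` the number of items in test `a` -/
  | rowLen (d a : ℕ)
  /-- `d :=` the item at position `b` in the list of the items in test `a` -/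
  | rowGet (d a b : ℕ)
  /-- continue at position `t` of the program if `a < b` -/
  | jumpLT (a b t : ℕ)
  /-- append `a` to the output -/
  | emit (a : ℕ)
  /-- stop -/
  | halt

/-- A program is a finite list of instructions. -/
abbrev Program : Type := List Instr

/-- The data the decoder can read. -/
structure DecoderInput : Type where
  /-- number of items -/
  N : ℕ
  /-- upper bound on the number of defective items -/
  K : ℕ
  /-- number of tests -/
  M : ℕ
  /-- the test matrix -/
  A : TestMatrix M N
  /-- the observed test results -/
  y : Fin M → Bool

namespace DecoderInput

/-- The observed result of test `i` as a bit, `0` out of range. -/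
def outcomeAt (I : DecoderInput) (i : ℕ) : ℕ :=
  if h : i < I.M then (I.y ⟨i, h⟩).toNat else 0

/-- The matrix entry at test `i`, item `j`, `false` out of range. -/
def entryAt (I : DecoderInput) (i j : ℕ) : Bool :=
  if h : i < I.M ∧ j < I.N then I.A ⟨i, h.1⟩ ⟨j, h.2⟩ else false

/-- The increasing list of the tests that contain item `j`. -/
def colList (I : DecoderInput) (j : ℕ) : List ℕ :=
  (List.range I.M).filter fun i => I.entryAt i j

/-- The increasing list of the items in test `i`. -/
def rowList (I : DecoderInput) (i : ℕ) : List ℕ :=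
  (List.range I.N).filter fun j => I.entryAt i j

end DecoderInput

/-- A configuration of the machine. -/
structure Config : Type where
  /-- position in the program -/
  pc : ℕ
  /-- the registers -/
  reg : ℕ → ℕ
  /-- the memory -/
  mem : ℕ → ℕ
  /-- the words output so far -/
  out : List ℕ

/-- Write the word `v` (reduced to `w` bits) into register `d` and go to the next instruction. -/
def Config.write (w : ℕ) (s : Config) (d v : ℕ) : Config :=
  { s with pc := s.pc + 1, reg := Function.update s.reg d (v % 2 ^ w) }

/-- The effect of one instruction, with words of `w` bits. -/
def exec (w : ℕ) (I : DecoderInput) (s : Config) : Instr → Config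
  | .const d v => s.write w d v
  | .add d a b => s.write w d (s.reg a + s.reg b)
  | .sub d a b => s.write w d (s.reg a - s.reg b)
  | .mul d a b => s.write w d (s.reg a * s.reg b)
  | .div d a b => s.write w d (s.reg a / s.reg b)
  | .load d a => s.write w d (s.mem (s.reg a))
  | .store a b =>
      { s with pc := s.pc + 1, mem := Function.update s.mem (s.reg a) (s.reg b) }
  | .outcome d a => s.write w d (I.outcomeAt (s.reg a))
  | .entry d a b => s.write w d (I.entryAt (s.reg a) (s.reg b)).toNat
  | .colLen d a => s.write w d (I.colList (s.reg a)).length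
  | .colGet d a b => s.write w d ((I.colList (s.reg a)).getD (s.reg b) 0)
  | .rowLen d a => s.write w d (I.rowList (s.reg a)).length
  | .rowGet d a b => s.write w d ((I.rowList (s.reg a)).getD (s.reg b) 0)
  | .jumpLT a b t => { s with pc := if s.reg a < s.reg b then t else s.pc + 1 }
  | .emit a => { s with pc := s.pc + 1, out := s.out ++ [s.reg a] }
  | .halt => s

/-- The instruction about to be executed; running past the end of the program means halting. -/
def nextInstr (P : Program) (s : Config) : Instr := P.getD s.pc .halt

/-- The initial configuration: registers `0`, `1`, `2` hold `N`, `K`, `M`. -/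
def initConfig (w : ℕ) (I : DecoderInput) : Config where
  pc := 0
  reg := fun r =>
    if r = 0 then I.N % 2 ^ w else if r = 1 then I.K % 2 ^ w else if r = 2 then I.M % 2 ^ w else 0
  mem := fun _ => 0
  out := []

/-- The configuration after `t` steps. -/
def runSteps (w : ℕ) (P : Program) (I : DecoderInput) (t : ℕ) : Config :=
  (fun s => exec w I s (nextInstr P s))^[t] (initConfig w I)

/-- The program has halted after at most `t` steps. -/
def HaltsWithin (w : ℕ) (P : Program) (I : DecoderInput) (t : ℕ) : Prop :=
  nextInstr P (runSteps w P I t) = .halt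

/-- The program halts after at most `t` steps, and the set of the words it has output
is exactly `S`. -/
def OutputsWithin (w : ℕ) (P : Program) (I : DecoderInput) (t : ℕ) (S : Finset (Fin I.N)) : Prop :=
  HaltsWithin w P I t ∧ (runSteps w P I t).out.toFinset = S.map Fin.valEmbedding

/-! ### Failure probability of a scheme -/

open Classical in
/-- The probability, over the random test matrix with law `μ` and over the channel noise, that the
decoder `P`, run for at most `t` steps, does not return the defective set `S`. -/
noncomputable def failureProb (ρ : ℝ) (w : ℕ) (P : Program) (t : ℕ) {M N : ℕ} (K : ℕ)
    (μ : PMF (TestMatrix M N)) (S : Finset (Fin N)) : ℝ :=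
  ∑ A : TestMatrix M N, (μ A).toReal * ∑ y : Fin M → Bool, fpcProb ρ (trueResult A S) y *
    (if OutputsWithin w P ⟨N, K, M, A, y⟩ t S then 0 else 1)

/-- The number of tests: `C e^(b+2) ζ K log N`, rounded down. -/
noncomputable def numTests (C ζ : ℝ) (b K N : ℕ) : ℕ :=
  ⌊C * Real.exp (b + 2) * ζ * K * Real.log N⌋₊

/-- The step bound `D ε⁻² K log N`, rounded down. -/
noncomputable def stepBound (D ε : ℝ) (K N : ℕ) : ℕ :=
  ⌊D * (ε ^ 2)⁻¹ * K * Real.log N⌋₊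

end GroupTesting

/-!
The hypotheses force `ρ ≤ (log 2) ^ 2 < 0.481`, `ζ ≥ 2` (`density_and_rate`) and `C ≥ 2 * (1 + η)`
(`le_of_isLittleO`), so that at least `80 * (1 + η) * K * log N` tests are available.  About
half of them form the pool of the following scheme, whose running time does not grow as `ε` tends
to `0`.

The items are the leaves `N + j` of a binary heap with inner nodes `1, …, N - 1`.  The tests used
form a pool of `r * r` tests, about `40 * (1 + η) * K * log N` many.  Every inner node is assigned
two and every item about `5 / 2 * (1 + η) * log N` private tests, independently and uniformly from
this one pool; an item belongs to its private tests and to the tests of its ancestors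
(`labelMatrix`).  The decoder explores the heap from the root, going below a node only if its two
tests are positive, and it returns a leaf that it reaches if all tests of the item are positive.

*Correctness.*  The channel never turns a positive result negative, so no defective item is lost.
Noise hits more than half of the pool only with probability exponentially small in its size
(`sum_noise_le`), and the defective items hit at most another `15` percent of it
(`card_positives_le`).  Given the positive tests, which depend only on the labels of the defective
items and their ancestors and on the noise, the private tests of another item are therefore all
positive with probability at most `0.65 ^ (5 / 2 * (1 + η) * log N) ≤ N ^ (-(1 + η))`.

*Time.*  Since all nodes share one pool, a node without defective items passes with conditional
probability at most `0.65 ^ 2 < 1 / 2`, independently of the other such nodes, and the exploration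
consists of the `O(K * log N)` ancestors of defective items and of subcritical branching processes
attached to them.  The exponential moment of its cost, a leaf counting as `O(log N)` steps, is
bounded by `exp (K + 1)` through a recursion on the heap (`sum_exp_exploreCost_le`), so the cost
exceeds a suitable multiple of `K * log N` with probability at most `exp (-b * K) ≤ K ^ (-b)`.  The
decoder counts its steps and gives up at that point, so it always halts in time
(`decoder_haltsWithin`).

*Random access to the labels.*  The column of an item lists its tests in increasing order, which
hides the tests assigned to a particular node.  Hence `4 * r` further rows serve as a lookup table:
item `v` belongs to one row in each of four blocks of `r` rows, and the positions of these rows in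
their blocks are the base-`r` digits of the two tests of node `v`.  They are the last four entries of
the column (`colList_labelMatrix`).
-/

set_option linter.unusedSimpArgs false

namespace GroupTesting

/-! ### Averaging over one coordinate of a uniformly random function -/

theorem sum_eq_sum_update {ι α : Type*} [Fintype ι] [DecidableEq ι] [Fintype α]
    (i : ι) (Φ : (ι → α) → ℝ) :
    (Fintype.card α : ℝ) * ∑ g, Φ g = ∑ g, ∑ x, Φ (Function.update g i x) := by
  classical
  have h1 : (Fintype.card α : ℝ) * ∑ g, Φ g = ∑ p : (ι → α) × α, Φ p.1 := by
    rw [Fintype.sum_prod_type, Finset.mul_sum]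
    refine Finset.sum_congr rfl fun g _ => ?_
    simp
  rw [h1, ← Fintype.sum_prod_type' (f := fun g x => Φ (Function.update g i x))]
  -- exchanging the coordinate `g i` with the fresh value `x` is an involution
  refine Finset.sum_bij' (fun p _ => (Function.update p.1 i p.2, p.1 i))
    (fun p _ => (Function.update p.1 i p.2, p.1 i)) ?_ ?_ ?_ ?_ ?_ <;> simp

/-- If, whatever the other coordinates are, the event `E` has conditional probability at most `q`
given them, and the weight `X` ignores coordinate `i`, then `E` costs a factor `q`. -/
theorem sum_mul_indicator_le {ι α : Type*} [Fintype ι] [DecidableEq ι] [Fintype α] [Nonempty α]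
    (i : ι) (X : (ι → α) → ℝ) (hX : ∀ g, 0 ≤ X g)
    (hXi : ∀ g x, X (Function.update g i x) = X g) (E : (ι → α) → Prop) [DecidablePred E] (q : ℝ)
    (hE : ∀ g, ((Finset.univ.filter fun x => E (Function.update g i x)).card : ℝ)
      ≤ q * Fintype.card α) :
    ∑ g, X g * (if E g then 1 else 0) ≤ q * ∑ g, X g := by
  have hc : (0 : ℝ) < Fintype.card α := by exact_mod_cast Fintype.card_pos
  refine le_of_mul_le_mul_left ?_ hc
  rw [sum_eq_sum_update i, Finset.mul_sum, Finset.mul_sum]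
  refine Finset.sum_le_sum fun g _ => ?_
  simp only [hXi, ← Finset.mul_sum, Finset.sum_boole]
  nlinarith [hX g, hE g, mul_le_mul_of_nonneg_left (hE g) (hX g)]

/-! ### The cost of exploring a binary heap -/

/-- The cost of exploring the subtree of the heap below node `v`, the children of `v` being `2 * v`
and `2 * v + 1` and the nodes from `N` on being leaves: a leaf costs `L`, an inner node costs `1`
and its children are explored if it passes the test `p`.  The first argument bounds the depth. -/
def exploreCost (N L : ℕ) (p : ℕ → Bool) : ℕ → ℕ → ℕ
  | 0, _ => L
  | n + 1, v => if N ≤ v then L else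
      1 + if p v then exploreCost N L p n (2 * v) + exploreCost N L p n (2 * v + 1) else 0

/-- `u` lies in the subtree of the heap with root `v`. -/
def Below (v u : ℕ) : Prop := ∃ k, u / 2 ^ k = v

theorem below_refl (v : ℕ) : Below v v := ⟨0, by simp⟩

theorem Below.parent {v u : ℕ} (h : Below v u) : Below (v / 2) u := by
  obtain ⟨k, rfl⟩ := h
  exact ⟨k + 1, by rw [pow_succ, Nat.div_div_eq_div_mul]⟩

theorem Below.of_left {v u : ℕ} (h : Below (2 * v) u) : Below v u := by
  simpa using h.parent

theorem Below.of_right {v u : ℕ} (h : Below (2 * v + 1) u) : Below v u := by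
  have := h.parent
  rwa [show (2 * v + 1) / 2 = v by omega] at this

theorem Below.le {v u : ℕ} (h : Below v u) : v ≤ u := by
  obtain ⟨k, rfl⟩ := h
  exact Nat.div_le_self _ _

theorem not_below_left_right {v u : ℕ} (hv : 0 < v) (h1 : Below (2 * v) u)
    (h2 : Below (2 * v + 1) u) : False := by
  obtain ⟨k, hk⟩ := h1
  obtain ⟨l, hl⟩ := h2
  rcases lt_trichotomy k l with h | h | h
  · obtain ⟨m, rfl⟩ := Nat.exists_eq_add_of_lt h
    have : u / 2 ^ (k + m + 1) ≤ u / 2 ^ k :=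
      Nat.div_le_div_left (Nat.pow_le_pow_right (by norm_num) (by omega)) (by positivity)
    omega
  · subst h; omega
  · obtain ⟨m, rfl⟩ := Nat.exists_eq_add_of_lt h
    have h3 : u / 2 ^ (l + m + 1) ≤ u / 2 ^ (l + 1) :=
      Nat.div_le_div_left (Nat.pow_le_pow_right (by norm_num) (by omega)) (by positivity)
    have h4 : u / 2 ^ (l + 1) = u / 2 ^ l / 2 := by rw [pow_succ, Nat.div_div_eq_div_mul]
    omega

theorem exploreCost_congr {N L : ℕ} {p p' : ℕ → Bool} :
    ∀ n v, 0 < v → (∀ u, u < N → Below v u → p u = p' u) →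
      exploreCost N L p n v = exploreCost N L p' n v
  | 0, _, _, _ => rfl
  | n + 1, v, hv, h => by
    by_cases hN : N ≤ v
    · simp [exploreCost, hN]
    · simp only [exploreCost, hN, if_false, h v (by omega) (below_refl v)]
      rw [exploreCost_congr n (2 * v) (by omega) fun u hu hb => h u hu hb.of_left,
        exploreCost_congr n (2 * v + 1) (by omega) fun u hu hb => h u hu hb.of_right]

/-- Exponent bounding the exploration of a subtree of height `n` without defective items. -/
noncomputable def clearExponent (lam κ : ℝ) : ℕ → ℝ
  | 0 => 2 * κ
  | n + 1 => 9 / 10 * clearExponent lam κ n + lam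

/-- Exponent bounding the exploration of a subtree of height `n`, per defective item in it. -/
noncomputable def defectExponent (lam κ : ℝ) : ℕ → ℝ
  | 0 => κ
  | n + 1 => defectExponent lam κ n + clearExponent lam κ n + lam

theorem clearExponent_nonneg {lam κ : ℝ} (hl : 0 ≤ lam) (hκ : 0 ≤ κ) (n : ℕ) :
    0 ≤ clearExponent lam κ n := by
  induction n with
  | zero => simp [clearExponent, hκ]
  | succ n ih => simp only [clearExponent]; positivity

theorem clearExponent_le {lam κ : ℝ} (hlκ : 5 * lam ≤ κ) (hκ : κ ≤ 1 / 64) (n : ℕ) :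
    clearExponent lam κ n ≤ 1 / 32 := by
  induction n with
  | zero => simp only [clearExponent]; linarith
  | succ n ih => simp only [clearExponent]; linarith

theorem defectExponent_add (lam κ : ℝ) (n : ℕ) :
    defectExponent lam κ n + 10 * clearExponent lam κ n = 21 * κ + 11 * lam * n := by
  induction n with
  | zero => simp only [defectExponent, clearExponent]; push_cast; ring
  | succ n ih => simp only [defectExponent, clearExponent]; push_cast; linarith

theorem le_defectExponent {lam κ : ℝ} (hl : 0 ≤ lam) (hκ : 0 ≤ κ) (n : ℕ) :
    κ ≤ defectExponent lam κ n := by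
  induction n with
  | zero => simp [defectExponent]
  | succ n ih =>
    simp only [defectExponent]
    linarith [clearExponent_nonneg hl hκ n]

/-- A node without defective items passes with probability at most `0.65² = 0.4225 < 1/2`, so that
the exploration below it is a subcritical branching process. -/
theorem subcritical_step {lam x : ℝ} (hx : 0 ≤ x) (hx' : x ≤ 1 / 32) :
    Real.exp lam * (1 + 169 / 400 * (Real.exp x * Real.exp x - 1)) ≤
      Real.exp (9 / 10 * x + lam) := by
  have h1 : Real.exp x * Real.exp x - 1 ≤ 17 / 8 * x := by
    rw [← Real.exp_add]
    have h := Real.abs_exp_sub_one_sub_id_le (x := x + x) (by rw [abs_le]; constructor <;> linarith)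
    have := (abs_le.mp h).2
    nlinarith
  have h2 : 1 + 169 / 400 * (Real.exp x * Real.exp x - 1) ≤ Real.exp (9 / 10 * x) := by
    have := Real.add_one_le_exp (9 / 10 * x)
    nlinarith
  rw [add_comm _ lam, Real.exp_add]
  exact mul_le_mul_of_nonneg_left h2 (Real.exp_pos _).le

/-- Exponential moment of the exploration cost below `v`.  Every node carries an independent uniform
label in `α`; `cnt v` is the number of defective items below `v`.  The labels of the nodes with
`cnt = 0` influence only whether these nodes pass. -/
theorem sum_exp_exploreCost_le {N L d : ℕ} {α : Type*} [Fintype α] [Nonempty α]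
    (cnt : ℕ → ℕ) (hcnt : ∀ v, 0 < v → v < N → cnt v = cnt (2 * v) + cnt (2 * v + 1))
    (surv : (Fin N → α) → ℕ → Bool)
    (hupd : ∀ g (u : Fin N) x (v : ℕ), cnt u = 0 → v ≠ u →
      surv (Function.update g u x) v = surv g v)
    (havg : ∀ g (u : Fin N), cnt u = 0 →
      ((Finset.univ.filter fun x => surv (Function.update g u x) u = true).card : ℝ)
        ≤ 169 / 400 * Fintype.card α)
    (hd : 2 ^ d ≤ 2 * N) {lam κ : ℝ} (hl : 0 ≤ lam) (hlκ : 5 * lam ≤ κ)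
    (hκ : κ ≤ 1 / 64) (hL : lam * L ≤ κ) :
    ∀ n v, 0 < v → (v + 1) * 2 ^ n ≤ 2 ^ (d + 1) →
      ∀ X : (Fin N → α) → ℝ, (∀ g, 0 ≤ X g) →
        (∀ g (u : Fin N) x, cnt u = 0 → Below v u → X (Function.update g u x) = X g) →
        ∑ g, X g * Real.exp (lam * exploreCost N L (surv g) n v) ≤
          Real.exp (if cnt v = 0 then clearExponent lam κ n
            else cnt v * defectExponent lam κ n) * ∑ g, X g := by
  have hκ0 : 0 ≤ κ := by linarith
  have hleaf : ∀ n v, n < 2 → κ ≤ (if cnt v = 0 then clearExponent lam κ n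
            else cnt v * defectExponent lam κ n) := by
    intro n v hn
    split_ifs with h
    · interval_cases n <;> simp only [clearExponent] <;> linarith
    · have h1 : (1 : ℝ) ≤ cnt v := by exact_mod_cast Nat.one_le_iff_ne_zero.mpr h
      nlinarith [le_defectExponent hl hκ0 n]
  have hbase : ∀ n v, n < 2 → ∀ X : (Fin N → α) → ℝ, (∀ g, 0 ≤ X g) →
      ∑ g, X g * Real.exp (lam * L) ≤ Real.exp (if cnt v = 0 then clearExponent lam κ n
            else cnt v * defectExponent lam κ n) * ∑ g, X g := by
    intro n v hn X hX
    rw [← Finset.sum_mul, mul_comm]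
    exact mul_le_mul_of_nonneg_right (Real.exp_le_exp.mpr (hL.trans (hleaf n v hn)))
      (Finset.sum_nonneg fun g _ => hX g)
  intro n
  induction n with
  | zero =>
    intro v hv h2 X hX hXi
    simpa only [exploreCost] using hbase 0 v (by norm_num) X hX
  | succ n ih =>
    intro v hv h2 X hX hXi
    by_cases hN : N ≤ v
    · simp only [exploreCost, hN, if_true]
      refine hbase (n + 1) v ?_ X hX
      -- a leaf occurs only in the last two layers
      by_contra hn
      have h4 : 2 ^ 2 ≤ 2 ^ (n + 1) := Nat.pow_le_pow_right (by norm_num) (by omega)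
      have h5 : (v + 1) * 2 ^ 2 ≤ (v + 1) * 2 ^ (n + 1) := Nat.mul_le_mul_left _ h4
      rw [pow_succ 2 d] at h2
      omega
    have hvN : v < N := by omega
    have hl2 : (2 * v + 1) * 2 ^ n ≤ 2 ^ (d + 1) := by
      rw [pow_succ 2 n] at h2; nlinarith [Nat.zero_le (2 ^ n)]
    have hr2 : (2 * v + 1 + 1) * 2 ^ n ≤ 2 ^ (d + 1) := by
      rw [pow_succ 2 n] at h2; nlinarith [Nat.zero_le (2 ^ n)]
    have ihl := ih (2 * v) (by omega) hl2
    have ihr := ih (2 * v + 1) (by omega) hr2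
    set Γl := Real.exp (if cnt (2 * v) = 0 then clearExponent lam κ n
            else cnt (2 * v) * defectExponent lam κ n) with hΓl
    set Γr := Real.exp (if cnt (2 * v + 1) = 0 then clearExponent lam κ n
            else cnt (2 * v + 1) * defectExponent lam κ n) with hΓr
    have hΓl0 : 0 < Γl := Real.exp_pos _
    have hΓr0 : 0 < Γr := Real.exp_pos _
    -- the labels below one child do not influence the cost below the other
    have hsurv : ∀ g (u : Fin N) x w, cnt u = 0 → 0 < w → ¬ Below w u →
        exploreCost N L (surv (Function.update g u x)) n w = exploreCost N L (surv g) n w := by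
      intro g u x w hu hw hb
      refine exploreCost_congr n w hw fun u' _ hb' => hupd g u x u' hu ?_
      rintro rfl
      exact hb hb'
    set p : (Fin N → α) → ℝ := fun g => if surv g v = true then 1 else 0 with hp
    have hp0 : ∀ g, 0 ≤ p g := fun g => by simp only [hp]; split_ifs <;> norm_num
    have hp1 : ∀ g, p g ≤ 1 := fun g => by simp only [hp]; split_ifs <;> norm_num
    have hpi : ∀ g (u : Fin N) x, cnt u = 0 → v ≠ u → p (Function.update g u x) = p g := by
      intro g u x hu hne
      simp only [hp, hupd g u x v hu hne]
    have hchild : ∑ g, X g * p g * Real.exp (lam * exploreCost N L (surv g) n (2 * v + 1)) *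
        Real.exp (lam * exploreCost N L (surv g) n (2 * v)) ≤ Γl * (Γr * ∑ g, X g * p g) := by
      refine (ihl _ (fun g => mul_nonneg (mul_nonneg (hX g) (hp0 g)) (Real.exp_pos _).le)
        ?_).trans (mul_le_mul_of_nonneg_left
          (ihr _ (fun g => mul_nonneg (hX g) (hp0 g)) ?_) hΓl0.le)
      · intro g u x hu hb
        have hne : v ≠ u := by have := hb.le; omega
        rw [hXi g u x hu hb.of_left, hpi g u x hu hne,
          hsurv g u x _ hu (by omega) fun hb' => not_below_left_right hv hb hb']
      · intro g u x hu hb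
        have hne : v ≠ u := by have := hb.le; omega
        rw [hXi g u x hu hb.of_right, hpi g u x hu hne]
    have hsplit : ∑ g, X g * Real.exp (lam * exploreCost N L (surv g) (n + 1) v) =
        Real.exp lam * (∑ g, X g - ∑ g, X g * p g +
          ∑ g, X g * p g * Real.exp (lam * exploreCost N L (surv g) n (2 * v + 1)) *
            Real.exp (lam * exploreCost N L (surv g) n (2 * v))) := by
      rw [← Finset.sum_sub_distrib, ← Finset.sum_add_distrib, Finset.mul_sum]
      refine Finset.sum_congr rfl fun g _ => ?_
      by_cases hs : surv g v = true
      · simp only [exploreCost, hN, hs, if_true, if_false, hp]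
        push_cast
        rw [show lam * (1 + ((exploreCost N L (surv g) n (2 * v) : ℝ) +
          exploreCost N L (surv g) n (2 * v + 1))) = lam + (lam *
            exploreCost N L (surv g) n (2 * v + 1) + lam * exploreCost N L (surv g) n (2 * v))
            by ring, Real.exp_add, Real.exp_add]
        ring
      · simp only [exploreCost, hN, hs, if_false, hp]
        push_cast
        simp only [add_zero, mul_one, mul_zero, sub_zero, zero_mul]
        ring
    rw [hsplit]
    have hXs : 0 ≤ ∑ g, X g := Finset.sum_nonneg fun g _ => hX g
    have hXp : 0 ≤ ∑ g, X g * p g := Finset.sum_nonneg fun g _ => mul_nonneg (hX g) (hp0 g)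
    have hXp1 : ∑ g, X g * p g ≤ ∑ g, X g :=
      Finset.sum_le_sum fun g _ => mul_le_of_le_one_right (hX g) (hp1 g)
    have hBn := clearExponent_nonneg hl hκ0 n
    have hBn' := clearExponent_le hlκ hκ n
    have hAn := (hκ0.trans (le_defectExponent hl hκ0 n))
    have hc := hcnt v hv hvN
    have hΓl1 : 1 ≤ Γl := Real.one_le_exp (by split_ifs <;> positivity)
    have hΓr1 : 1 ≤ Γr := Real.one_le_exp (by split_ifs <;> positivity)
    have hΓ1 : 1 ≤ Γl * Γr := one_le_mul_of_one_le_of_one_le hΓl1 hΓr1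
    by_cases h0 : cnt v = 0
    · have hq : ∑ g, X g * p g ≤ 169 / 400 * ∑ g, X g := by
        refine sum_mul_indicator_le ⟨v, hvN⟩ X hX (fun g x => hXi g ⟨v, hvN⟩ x h0 (below_refl v))
          (fun g => surv g v = true) _ fun g => ?_
        exact havg g ⟨v, hvN⟩ h0
      have hl0 : cnt (2 * v) = 0 := by omega
      have hr0 : cnt (2 * v + 1) = 0 := by omega
      rw [if_pos h0]
      rw [if_pos hl0] at hΓl
      rw [if_pos hr0] at hΓr
      have hstep := subcritical_step (lam := lam) hBn hBn'
      rw [← hΓl] at hstep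
      simp only [clearExponent]
      have hΓlr : Γr = Γl := by rw [hΓl, hΓr]
      rw [hΓlr] at hchild hΓ1
      calc _ ≤ Real.exp lam * (∑ g, X g - ∑ g, X g * p g + Γl * (Γl * ∑ g, X g * p g)) := by
            gcongr
        _ = Real.exp lam * (∑ g, X g + (Γl * Γl - 1) * ∑ g, X g * p g) := by ring
        _ ≤ Real.exp lam * (∑ g, X g + (Γl * Γl - 1) * (169 / 400 * ∑ g, X g)) := by
            gcongr
        _ = Real.exp lam * (1 + 169 / 400 * (Γl * Γl - 1)) * ∑ g, X g := by ring
        _ ≤ _ := mul_le_mul_of_nonneg_right hstep hXs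
    · rw [if_neg h0]
      have hΓ : Real.exp lam * (Γl * Γr) ≤
          Real.exp (cnt v * defectExponent lam κ (n + 1)) := by
        rw [hΓl, hΓr, ← Real.exp_add, ← Real.exp_add, Real.exp_le_exp]
        simp only [defectExponent]
        have hc' : (cnt (2 * v) : ℝ) + cnt (2 * v + 1) = cnt v := by exact_mod_cast hc.symm
        have h1' : (1 : ℝ) ≤ cnt v := by exact_mod_cast Nat.one_le_iff_ne_zero.mpr h0
        have e1 : lam + clearExponent lam κ n ≤ cnt v * (clearExponent lam κ n + lam) := by
          nlinarith
        have e2 := congrArg (fun z => z * defectExponent lam κ n) hc'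
        by_cases hl0 : cnt (2 * v) = 0 <;> by_cases hr0 : cnt (2 * v + 1) = 0
        · omega
        · simp only [hl0, hr0, if_true, if_false]
          rw [hl0] at e2; push_cast at e2
          nlinarith
        · simp only [hl0, hr0, if_true, if_false]
          rw [hr0] at e2; push_cast at e2
          nlinarith
        · simp only [hl0, hr0, if_false]
          nlinarith
      calc _ ≤ Real.exp lam * (∑ g, X g - ∑ g, X g * p g + Γl * (Γr * ∑ g, X g * p g)) := by
            gcongr
        _ = Real.exp lam * (∑ g, X g + (Γl * Γr - 1) * ∑ g, X g * p g) := by ring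
        _ ≤ Real.exp lam * (∑ g, X g + (Γl * Γr - 1) * ∑ g, X g) := by
            gcongr
        _ = Real.exp lam * (Γl * Γr) * ∑ g, X g := by ring
        _ ≤ _ := mul_le_mul_of_nonneg_right hΓ hXs

/-! ### The pool of tests and its random labels -/

/-- `v` is one of the `d` lowest proper ancestors of the leaf `N + j` that represents item `j`. -/
def IsAncestor (N d v j : ℕ) : Prop := ∃ k < d, (N + j) / 2 ^ (k + 1) = v

/-- The number of items of `S` in the subtree of the heap below node `v`. -/
noncomputable def countBelow {N : ℕ} (S : Finset (Fin N)) (v : ℕ) : ℕ :=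
  open Classical in (S.filter fun j : Fin N => Below v (N + j)).card

theorem countBelow_le {N : ℕ} (S : Finset (Fin N)) (v : ℕ) : countBelow S v ≤ S.card := by
  classical
  unfold countBelow
  exact Finset.card_filter_le _ _

theorem countBelow_eq_add {N : ℕ} (S : Finset (Fin N)) {v : ℕ} (hv : 0 < v) (hvN : v < N) :
    countBelow S v = countBelow S (2 * v) + countBelow S (2 * v + 1) := by
  classical
  unfold countBelow
  rw [← Finset.card_union_of_disjoint, ← Finset.filter_or]
  · congr 1
    refine Finset.filter_congr fun j _ => ⟨?_, ?_⟩
    · rintro ⟨k, hk⟩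
      rcases k with _ | k
      · simp at hk; omega
      · rw [pow_succ, ← Nat.div_div_eq_div_mul] at hk
        have : (N + j) / 2 ^ k = 2 * v ∨ (N + j) / 2 ^ k = 2 * v + 1 := by omega
        exact this.imp (fun h => ⟨k, h⟩) fun h => ⟨k, h⟩
    · rintro (h | h)
      exacts [h.of_left, h.of_right]
  · refine Finset.disjoint_filter.mpr fun j _ h1 h2 => not_below_left_right hv h1 h2

theorem not_isAncestor_of_countBelow_eq_zero {N d : ℕ} {S : Finset (Fin N)} {v : ℕ}
    (h : countBelow S v = 0) {j : Fin N} (hj : j ∈ S) : ¬ IsAncestor N d v j := by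
  classical
  rintro ⟨k, _, hk⟩
  rw [countBelow, Finset.card_eq_zero, Finset.filter_eq_empty_iff] at h
  exact h hj ⟨k + 1, hk⟩

/-- Item `j` belongs to the pooled test `i`: either `i` is one of the `t` private tests `c j` of the
item, or it is one of the two tests `g v` of an ancestor `v` of its leaf. -/
def InPool {N T t : ℕ} (d : ℕ) (g : Fin N → Fin 2 → Fin T) (c : Fin N → Fin t → Fin T)
    (i : Fin T) (j : Fin N) : Prop :=
  (∃ k, c j k = i) ∨ ∃ (v : Fin N) (e : Fin 2), IsAncestor N d v j ∧ g v e = i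

/-- The pooled tests reported positive when `z` is the set of the tests hit by noise. -/
noncomputable def positives {N T t : ℕ} (d : ℕ) (S : Finset (Fin N)) (z : Finset (Fin T))
    (g : Fin N → Fin 2 → Fin T) (c : Fin N → Fin t → Fin T) : Finset (Fin T) :=
  open Classical in Finset.univ.filter fun i => i ∈ z ∨ ∃ j ∈ S, InPool d g c i j

theorem mem_positives {N T t d : ℕ} {S : Finset (Fin N)} {z : Finset (Fin T)}
    {g : Fin N → Fin 2 → Fin T} {c : Fin N → Fin t → Fin T} {i : Fin T} :
    i ∈ positives d S z g c ↔ i ∈ z ∨ ∃ j ∈ S, InPool d g c i j := by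
  classical
  simp [positives]

/-- Node `v` passes if its two tests are in `Y`. -/
noncomputable def nodePass {N T : ℕ} (Y : Finset (Fin T)) (g : Fin N → Fin 2 → Fin T) (v : ℕ) :
    Bool :=
  if h : v < N then decide (∀ e, g ⟨v, h⟩ e ∈ Y) else false

theorem card_positives_le {N T t : ℕ} (d : ℕ) (S : Finset (Fin N)) (z : Finset (Fin T))
    (g : Fin N → Fin 2 → Fin T) (c : Fin N → Fin t → Fin T) :
    (positives d S z g c).card ≤ z.card + S.card * (t + 2 * d) := by
  classical
  set W : Fin N → Finset (Fin T) := fun j => (Finset.univ.image (c j)) ∪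
    ((Finset.univ : Finset (Fin d × Fin 2)).image fun p =>
      if h : (N + j) / 2 ^ ((p.1 : ℕ) + 1) < N then g ⟨_, h⟩ p.2 else g j p.2) with hW
  have hsub : positives d S z g c ⊆ z ∪ S.biUnion W := by
    intro i hi
    rw [mem_positives] at hi
    rw [Finset.mem_union, Finset.mem_biUnion]
    refine hi.imp id ?_
    rintro ⟨j, hj, h⟩
    refine ⟨j, hj, ?_⟩
    simp only [hW, Finset.mem_union, Finset.mem_image, Finset.mem_univ, true_and]
    refine h.imp id ?_
    rintro ⟨v, e, ⟨k, hk, hkv⟩, he⟩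
    refine ⟨(⟨k, hk⟩, e), ?_⟩
    have hlt : (N + j) / 2 ^ (k + 1) < N := hkv ▸ v.2
    rw [dif_pos hlt, ← he]
    congr 2
  have hWc : ∀ j ∈ S, (W j).card ≤ t + 2 * d := by
    intro j _
    refine (Finset.card_union_le _ _).trans (Nat.add_le_add ?_ ?_)
    · exact Finset.card_image_le.trans (by simp)
    · exact Finset.card_image_le.trans (by simp [mul_comm])
  calc _ ≤ (z ∪ S.biUnion W).card := Finset.card_le_card hsub
    _ ≤ z.card + (S.biUnion W).card := Finset.card_union_le _ _
    _ ≤ _ := Nat.add_le_add_left (Finset.card_biUnion_le_card_mul _ _ _ hWc) _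

theorem positives_update_left {N T t d : ℕ} {S : Finset (Fin N)} (z : Finset (Fin T))
    (g : Fin N → Fin 2 → Fin T) (c : Fin N → Fin t → Fin T) {u : Fin N} (x : Fin 2 → Fin T)
    (hu : countBelow S u = 0) :
    positives d S z (Function.update g u x) c = positives d S z g c := by
  classical
  ext i
  rw [mem_positives, mem_positives]
  refine or_congr_right (exists_congr fun j => and_congr_right fun hj => ?_)
  refine or_congr_right (exists_congr fun v => exists_congr fun e => and_congr_right fun hv => ?_)
  have hne : v ≠ u := by
    intro h
    subst h
    exact not_isAncestor_of_countBelow_eq_zero hu hj hv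
  rw [Function.update_of_ne hne]

theorem positives_update_right {N T t d : ℕ} {S : Finset (Fin N)} (z : Finset (Fin T))
    (g : Fin N → Fin 2 → Fin T) (c : Fin N → Fin t → Fin T) {u : Fin N} (x : Fin t → Fin T)
    (hu : u ∉ S) :
    positives d S z g (Function.update c u x) = positives d S z g c := by
  classical
  ext i
  rw [mem_positives, mem_positives]
  refine or_congr_right (exists_congr fun j => and_congr_right fun hj => ?_)
  have hne : j ≠ u := by
    rintro rfl
    exact hu hj
  unfold InPool
  rw [Function.update_of_ne hne]

theorem card_filter_forall_mem {T m : ℕ} (Y : Finset (Fin T)) :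
    (Finset.univ.filter fun x : Fin m → Fin T => ∀ e, x e ∈ Y).card = Y.card ^ m := by
  have : (Finset.univ.filter fun x : Fin m → Fin T => ∀ e, x e ∈ Y) =
      Fintype.piFinset fun _ => Y := by
    ext x; simp
  rw [this, Fintype.card_piFinset_const]

section Bounds

variable {N T t d : ℕ} {S : Finset (Fin N)} {z : Finset (Fin T)}

/-- Exponential moment of the cost of the whole exploration, over the labels of the nodes. -/
theorem sum_exp_exploreCost_root_le {L : ℕ} (hT : 0 < T) (c : Fin N → Fin t → Fin T)
    (hpos : ∀ g, ((positives d S z g c).card : ℝ) ≤ 13 / 20 * T)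
    (hd : 2 ^ d ≤ 2 * N) (hdL : d ≤ L) (hL : 5 ≤ L) :
    ∑ g : Fin N → Fin 2 → Fin T,
      Real.exp (1 / (64 * L) * exploreCost N L (nodePass (positives d S z g c) g) d 1) ≤
        Real.exp (S.card + 1) * Fintype.card (Fin N → Fin 2 → Fin T) := by
  classical
  have : Nonempty (Fin T) := ⟨⟨0, hT⟩⟩
  have hL0 : (5 : ℝ) ≤ L := by exact_mod_cast hL
  have hlam5 : 5 * (1 / (64 * (L : ℝ))) ≤ 1 / 64 := by
    rw [show 5 * (1 / (64 * (L : ℝ))) = 1 / 64 * (5 / L) by field_simp]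
    have : (5 : ℝ) / L ≤ 1 := div_le_one_of_le₀ hL0 (by positivity)
    linarith
  have key := sum_exp_exploreCost_le (N := N) (L := L) (d := d) (α := Fin 2 → Fin T)
    (countBelow S) (fun v hv hvN => countBelow_eq_add S hv hvN)
    (fun g => nodePass (positives d S z g c) g) ?_ ?_ hd (lam := 1 / (64 * L)) (κ := 1 / 64)
    (by positivity) hlam5 le_rfl ?_ d 1 one_pos (by rw [pow_succ]; linarith) (fun _ => 1)
    (fun _ => zero_le_one) (fun _ _ _ _ _ => rfl)
  · simp only [one_mul, Finset.sum_const, Finset.card_univ, nsmul_eq_mul, mul_one] at key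
    refine key.trans (mul_le_mul_of_nonneg_right (Real.exp_le_exp.mpr ?_) (by positivity))
    have hlam : (0 : ℝ) ≤ 1 / (64 * L) := by positivity
    have hA := defectExponent_add (1 / (64 * L)) (1 / 64) d
    have hB := clearExponent_nonneg hlam (by norm_num : (0 : ℝ) ≤ 1 / 64) d
    have hdL' : (d : ℝ) ≤ L := by exact_mod_cast hdL
    have h1 : 11 * (1 / (64 * (L : ℝ))) * d ≤ 11 / 64 := by
      rw [show 11 * (1 / (64 * (L : ℝ))) * d = 11 / 64 * (d / L) by field_simp]
      have : (d : ℝ) / L ≤ 1 := div_le_one_of_le₀ hdL' (by positivity)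
      linarith
    split_ifs with h0
    · linarith [clearExponent_le (lam := 1 / (64 * L)) (κ := 1 / 64) hlam5 le_rfl d,
        Nat.cast_nonneg (α := ℝ) S.card]
    · have h2 : (countBelow S 1 : ℝ) ≤ S.card := by exact_mod_cast countBelow_le S 1
      nlinarith [Nat.cast_nonneg (α := ℝ) (countBelow S 1)]
  · intro g u x v hu hne
    simp only [positives_update_left z g c x hu, nodePass]
    split_ifs with h
    · rw [Function.update_of_ne (fun h' => hne (congrArg Fin.val h'))]
    · rfl
  · intro g u hu
    have h1 : ∀ x, (nodePass (positives d S z (Function.update g u x) c) (Function.update g u x) u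
        = true) ↔ ∀ e, x e ∈ positives d S z g c := by
      intro x
      simp only [positives_update_left z g c x hu, nodePass, u.2, dif_pos, decide_eq_true_eq,
        Function.update_self]
    simp only [h1, card_filter_forall_mem]
    have := hpos g
    push_cast
    simp only [Fintype.card_pi, Fintype.card_fin, Finset.prod_const, Finset.card_univ]
    push_cast
    nlinarith [Nat.cast_nonneg (α := ℝ) (positives d S z g c).card, Nat.cast_nonneg (α := ℝ) T]
  · rw [show 1 / (64 * (L : ℝ)) * L = 1 / 64 by field_simp]

/-- The chance that all private tests of an item outside `S` are positive. -/
theorem card_private_positive_le (hT : 0 < T) (g : Fin N → Fin 2 → Fin T)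
    (hpos : ∀ c : Fin N → Fin t → Fin T, ((positives d S z g c).card : ℝ) ≤ 13 / 20 * T)
    {j : Fin N} (hj : j ∉ S) :
    ∑ c : Fin N → Fin t → Fin T, (if ∀ k, c j k ∈ positives d S z g c then (1 : ℝ) else 0) ≤
      (13 / 20) ^ t * Fintype.card (Fin N → Fin t → Fin T) := by
  classical
  have : Nonempty (Fin T) := ⟨⟨0, hT⟩⟩
  have h := sum_mul_indicator_le (α := Fin t → Fin T) j (fun _ => 1) (fun _ => zero_le_one)
    (fun _ _ => rfl) (fun c => ∀ k, c j k ∈ positives d S z g c) ((13 / 20) ^ t) fun c => by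
      simp only [positives_update_right z g c _ hj, Function.update_self, card_filter_forall_mem]
      push_cast
      simp only [Fintype.card_pi, Fintype.card_fin, Finset.prod_const, Finset.card_univ]
      push_cast
      rw [← mul_pow]
      exact pow_le_pow_left₀ (by positivity) (hpos c) t
  simpa using h

/-- The event that the decoder may fail: the exploration costs more than `F`, or all private tests
of an item outside `S` are positive. -/
def BadLabels (d L F : ℕ) (S : Finset (Fin N)) (z : Finset (Fin T))
    (ω : (Fin N → Fin 2 → Fin T) × (Fin N → Fin t → Fin T)) : Prop :=
  F < exploreCost N L (nodePass (positives d S z ω.1 ω.2) ω.1) d 1 ∨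
    ∃ j ∉ S, ∀ k, ω.2 j k ∈ positives d S z ω.1 ω.2

open Classical in
/-- If the noise hits at most half of the pool, and the pool is large enough for the defective
items to hit at most a further 15 percent, failure is unlikely. -/
theorem sum_badLabels_le {L F : ℕ} (hT : 0 < T) (hd : 2 ^ d ≤ 2 * N) (hdL : d ≤ L)
    (hL : 5 ≤ L) (hz : (z.card : ℝ) ≤ T / 2)
    (hload : (S.card : ℝ) * (t + 2 * d) ≤ 3 / 20 * T) :
    ∑ ω : (Fin N → Fin 2 → Fin T) × (Fin N → Fin t → Fin T),
      (if BadLabels d L F S z ω then (1 : ℝ) else 0) ≤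
      (Real.exp (S.card + 1 - F / (64 * L)) + N * (13 / 20) ^ t) *
        Fintype.card ((Fin N → Fin 2 → Fin T) × (Fin N → Fin t → Fin T)) := by
  have hpos : ∀ (g : Fin N → Fin 2 → Fin T) (c : Fin N → Fin t → Fin T),
      ((positives d S z g c).card : ℝ) ≤ 13 / 20 * T := by
    intro g c
    have h : ((positives d S z g c).card : ℝ) ≤ z.card + S.card * (t + 2 * d) := by
      exact_mod_cast card_positives_le d S z g c
    linarith
  have hL0 : (0 : ℝ) < L := by exact_mod_cast (by omega : 0 < L)
  have hpt : ∀ ω : (Fin N → Fin 2 → Fin T) × (Fin N → Fin t → Fin T),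
      (if BadLabels d L F S z ω then (1 : ℝ) else 0) ≤
        Real.exp (-(F / (64 * L))) * Real.exp (1 / (64 * L) *
          exploreCost N L (nodePass (positives d S z ω.1 ω.2) ω.1) d 1) +
        ∑ j ∈ Sᶜ, (if ∀ k, ω.2 j k ∈ positives d S z ω.1 ω.2 then (1 : ℝ) else 0) := by
    intro ω
    have hs0 : (0 : ℝ) ≤
        ∑ j ∈ Sᶜ, (if ∀ k, ω.2 j k ∈ positives d S z ω.1 ω.2 then (1 : ℝ) else 0) :=
      Finset.sum_nonneg fun j _ => by split_ifs <;> norm_num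
    have he0 : 0 ≤ Real.exp (-(F / (64 * L))) * Real.exp (1 / (64 * L) *
          exploreCost N L (nodePass (positives d S z ω.1 ω.2) ω.1) d 1) := by positivity
    split_ifs with hb
    · rcases hb with hb | ⟨j, hj, hb⟩
      · have hF : (F : ℝ) ≤ exploreCost N L (nodePass (positives d S z ω.1 ω.2) ω.1) d 1 := by
          exact_mod_cast hb.le
        refine le_add_of_le_of_nonneg ?_ hs0
        rw [← Real.exp_add]
        refine Real.one_le_exp ?_
        rw [neg_add_eq_sub, sub_nonneg, div_eq_mul_one_div, mul_comm]
        gcongr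
      · refine le_add_of_nonneg_of_le he0 ?_
        refine le_trans ?_ (Finset.single_le_sum (f := fun j =>
          (if ∀ k, ω.2 j k ∈ positives d S z ω.1 ω.2 then (1 : ℝ) else 0))
          (fun j _ => by split_ifs <;> norm_num) (Finset.mem_compl.mpr hj))
        rw [if_pos hb]
    · positivity
  refine (Finset.sum_le_sum fun ω _ => hpt ω).trans ?_
  rw [Finset.sum_add_distrib, add_mul]
  refine add_le_add ?_ ?_
  · rw [← Finset.mul_sum, Fintype.sum_prod_type_right, sub_eq_neg_add, Real.exp_add, mul_assoc]
    refine mul_le_mul_of_nonneg_left ?_ (Real.exp_pos _).le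
    calc _ ≤ ∑ c : Fin N → Fin t → Fin T,
          Real.exp (S.card + 1) * (Fintype.card (Fin N → Fin 2 → Fin T) : ℝ) :=
          Finset.sum_le_sum fun c _ =>
            sum_exp_exploreCost_root_le hT c (fun g => hpos g c) hd hdL hL
      _ = _ := by
          rw [Finset.sum_const, Finset.card_univ, Fintype.card_prod]
          push_cast
          rw [nsmul_eq_mul]
          ring
  · rw [Finset.sum_comm]
    calc _ ≤ ∑ j ∈ Sᶜ, ((13 / 20 : ℝ) ^ t *
          Fintype.card ((Fin N → Fin 2 → Fin T) × (Fin N → Fin t → Fin T))) := by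
          refine Finset.sum_le_sum fun j hj => ?_
          rw [Fintype.sum_prod_type]
          refine (Finset.sum_le_sum fun g _ => card_private_positive_le hT g (fun c => hpos g c)
            (Finset.mem_compl.mp hj)).trans_eq ?_
          rw [Finset.sum_const, Finset.card_univ, Fintype.card_prod]
          push_cast
          rw [nsmul_eq_mul]
          ring
      _ ≤ _ := by
          rw [Finset.sum_const, nsmul_eq_mul, mul_assoc]
          have : (Sᶜ.card : ℝ) ≤ N := by
            exact_mod_cast (Finset.card_le_univ _).trans_eq (Fintype.card_fin N)
          gcongr

end Bounds

/-! ### The noise of the channel -/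

theorem fpcProb_nonneg {ρ : ℝ} (h0 : 0 ≤ ρ) (h1 : ρ ≤ 1) {M : ℕ} (v y : Fin M → Bool) :
    0 ≤ fpcProb ρ v y := by
  refine Finset.prod_nonneg fun i _ => ?_
  cases v i <;> cases y i <;> simp [fpcBit, h0, h1]

/-- The sum of a product over all bit vectors. -/
theorem sum_prod_bool {M : ℕ} (f : Fin M → Bool → ℝ) :
    ∑ z : Fin M → Bool, ∏ i, f i (z i) = ∏ i, (f i true + f i false) := by
  have := Finset.prod_univ_sum (fun _ : Fin M => (Finset.univ : Finset Bool)) f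
  simp only [Fintype.piFinset_univ, Fintype.sum_bool] at this
  exact this.symm

/-- The channel adds noise: its output is the disjunction of its input and the output `z` that it
produces from the all-negative input. -/
theorem sum_fpcProb_mul (ρ : ℝ) {M : ℕ} (v : Fin M → Bool) (f : (Fin M → Bool) → ℝ) :
    ∑ y, fpcProb ρ v y * f y =
      ∑ z, fpcProb ρ (fun _ => false) z * f (fun i => v i || z i) := by
  have h : ∀ y, fpcProb ρ v y = ∑ z, fpcProb ρ (fun _ => false) z *
      (if (fun i => v i || z i) = y then 1 else 0) := by
    intro y
    have h1 : ∀ z : Fin M → Bool, fpcProb ρ (fun _ => false) z *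
        (if (fun i => v i || z i) = y then 1 else 0) =
        ∏ i, (fpcBit ρ false (z i) * if (v i || z i) = y i then 1 else 0) := by
      intro z
      rw [Finset.prod_mul_distrib, Finset.prod_boole]
      simp [fpcProb, funext_iff]
    simp only [h1]
    rw [sum_prod_bool fun i b => fpcBit ρ false b * if (v i || b) = y i then 1 else 0]
    refine Finset.prod_congr rfl fun i _ => ?_
    cases v i <;> cases y i <;> simp [fpcBit]
  simp only [h, Finset.sum_mul]
  rw [Finset.sum_comm]
  refine Finset.sum_congr rfl fun z _ => ?_
  simp only [mul_assoc, ← Finset.mul_sum]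
  simp

theorem sum_fpcProb_eq_one (ρ : ℝ) {M : ℕ} (v : Fin M → Bool) : ∑ y, fpcProb ρ v y = 1 := by
  unfold fpcProb
  rw [sum_prod_bool fun i b => fpcBit ρ (v i) b]
  refine Finset.prod_eq_one fun i _ => ?_
  cases v i <;> simp [fpcBit]

/-- Chernoff bound: noise of density `ρ ≤ 0.481` rarely hits more than half of the tests in `I`. -/
theorem sum_noise_le {ρ : ℝ} (h0 : 0 ≤ ρ) (h1 : ρ ≤ 481 / 1000) {M : ℕ} (I : Finset (Fin M)) :
    ∑ z, fpcProb ρ (fun _ => false) z *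
      (if I.card < 2 * (I.filter fun i => z i = true).card then 1 else 0) ≤
      Real.exp (-(I.card / 2500)) := by
  -- the exponential weight of a hit, the square of `26 / 25`
  set w : Fin M → Bool → ℝ := fun i b => if i ∈ I then (if b then (26 / 25) ^ 2 else 1) else 1
    with hw
  have hpt : ∀ z : Fin M → Bool, (26 / 25 : ℝ) ^ I.card *
      (if I.card < 2 * (I.filter fun i => z i = true).card then 1 else 0) ≤ ∏ i, w i (z i) := by
    intro z
    have : ∏ i, w i (z i) = ((26 / 25 : ℝ) ^ 2) ^ (I.filter fun i => z i = true).card := by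
      simp only [hw]
      rw [Finset.prod_ite_mem, Finset.univ_inter, ← Finset.prod_filter, Finset.prod_const]
    rw [this, ← pow_mul]
    split_ifs with h
    · rw [mul_one]
      exact pow_le_pow_right₀ (by norm_num) h.le
    · rw [mul_zero]
      positivity
  have hpos : (0 : ℝ) < (26 / 25) ^ I.card := by positivity
  have hsum : ∑ z, fpcProb ρ (fun _ => false) z * ∏ i, w i (z i) ≤
      (26 / 25 * (2499 / 2500)) ^ I.card := by
    simp only [fpcProb, ← Finset.prod_mul_distrib]
    rw [sum_prod_bool fun i b => fpcBit ρ false b * w i b]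
    have : ∀ i, fpcBit ρ false true * w i true + fpcBit ρ false false * w i false =
        if i ∈ I then ρ * (26 / 25) ^ 2 + (1 - ρ) else 1 := by
      intro i
      by_cases hi : i ∈ I <;> simp [hw, fpcBit, hi]
    simp only [this]
    rw [Finset.prod_ite_mem, Finset.univ_inter, Finset.prod_const]
    refine pow_le_pow_left₀ (by nlinarith) (by nlinarith) _
  have hmain : (26 / 25 : ℝ) ^ I.card * ∑ z, fpcProb ρ (fun _ => false) z *
      (if I.card < 2 * (I.filter fun i => z i = true).card then 1 else 0) ≤
      (26 / 25 : ℝ) ^ I.card * (2499 / 2500) ^ I.card := by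
    rw [← mul_pow]
    refine le_trans ?_ hsum
    rw [Finset.mul_sum]
    refine Finset.sum_le_sum fun z _ => ?_
    rw [mul_left_comm]
    exact mul_le_mul_of_nonneg_left (hpt z) (fpcProb_nonneg h0 (by linarith) _ _)
  refine (le_of_mul_le_mul_left hmain hpos).trans ?_
  have h2 : (2499 / 2500 : ℝ) ≤ Real.exp (-(1 / 2500)) := by
    have := Real.add_one_le_exp (-(1 / 2500 : ℝ))
    linarith
  calc (2499 / 2500 : ℝ) ^ I.card ≤ Real.exp (-(1 / 2500)) ^ I.card :=
        pow_le_pow_left₀ (by norm_num) h2 _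
    _ = _ := by rw [← Real.exp_nat_mul]; congr 1; ring

/-! ### Random test matrices as images of uniformly random labels -/

/-- An average over the image of the uniform distribution on `Ω`. -/
theorem sum_map_uniform_mul {Ω β : Type*} [Fintype Ω] [Nonempty Ω] [Fintype β]
    (F : Ω → β) (f : β → ℝ) :
    ∑ A, ((PMF.uniformOfFintype Ω).map F A).toReal * f A =
      (∑ ω, f (F ω)) / Fintype.card Ω := by
  classical
  have h : ∀ A, ((PMF.uniformOfFintype Ω).map F A).toReal =
      ∑ ω, if A = F ω then (Fintype.card Ω : ℝ)⁻¹ else 0 := by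
    intro A
    rw [PMF.map_apply, tsum_fintype, ENNReal.toReal_sum]
    · refine Finset.sum_congr rfl fun ω _ => ?_
      split_ifs <;> simp
    · intro ω _
      split_ifs <;> simp
  simp only [h, Finset.sum_mul]
  rw [Finset.sum_comm, Finset.sum_div]
  refine Finset.sum_congr rfl fun ω _ => ?_
  simp [ite_mul, div_eq_inv_mul]

/-! ### The decoder program -/

/-- The decoder.  Registers: `3` holds `1`, `4` holds `0`, `5` the side length `r` of the pool,
`6` its size `r ^ 2`, `7`-`10` the first rows of the four blocks of the lookup table, `11` the fuel,
`12` the height of the stack, `13` the mode (`0`: explore, `1`: check the item in register `15`),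
`14` the current node, `16` a position in a column; `17` and `18` are scratch. -/
def decoder (cF : ℕ) : Program :=
  [ .const 3 1,
    .rowLen 5 4,
    .mul 6 5 5,
    .add 7 6 3,
    .add 8 7 5,
    .add 9 8 5,
    .add 10 9 5,
    .const 11 cF,
    .mul 11 11 6,
    .store 12 3,
    .add 12 12 3,
    -- the main loop, at position 11
    .jumpLT 4 11 13,
    .halt,
    .sub 11 11 3,
    .jumpLT 4 13 24,
    .jumpLT 4 12 17,
    .halt,
    .sub 12 12 3,
    .load 14 12,
    .jumpLT 14 0 33,
    -- a leaf: enter the checking mode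
    .sub 15 14 0,
    .colLen 16 15,
    .add 13 4 3,
    .jumpLT 4 3 11,
    -- checking mode: the tests of the item before position `16` are still to be read
    .jumpLT 4 16 28,
    .emit 15,
    .const 13 0,
    .jumpLT 4 3 11,
    .sub 16 16 3,
    .colGet 17 15 16,
    .outcome 18 17,
    .jumpLT 4 18 11,
    .jumpLT 4 3 26,
    -- an inner node: its second test
    .colLen 16 14,
    .sub 16 16 3,
    .colGet 17 14 16,
    .sub 17 17 10,
    .sub 16 16 3,
    .colGet 18 14 16,
    .sub 18 18 9,
    .mul 18 18 5,
    .add 18 18 17,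
    .add 18 18 3,
    .outcome 18 18,
    .jumpLT 4 18 46,
    .jumpLT 4 3 11,
    -- its first test
    .sub 16 16 3,
    .colGet 17 14 16,
    .sub 17 17 8,
    .sub 16 16 3,
    .colGet 18 14 16,
    .sub 18 18 7,
    .mul 18 18 5,
    .add 18 18 17,
    .add 18 18 3,
    .outcome 18 18,
    .jumpLT 4 18 58,
    .jumpLT 4 3 11,
    -- push the children
    .add 14 14 14,
    .store 12 14,
    .add 12 12 3,
    .add 14 14 3,
    .store 12 14,
    .add 12 12 3,
    .jumpLT 4 3 11 ]

/-- One step of the machine. -/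
def step (w : ℕ) (P : Program) (I : DecoderInput) (s : Config) : Config :=
  exec w I s (nextInstr P s)

theorem runSteps_eq (w : ℕ) (P : Program) (I : DecoderInput) (t : ℕ) :
    runSteps w P I t = (step w P I)^[t] (initConfig w I) := rfl

theorem runSteps_succ (w : ℕ) (P : Program) (I : DecoderInput) (t : ℕ) :
    runSteps w P I (t + 1) = step w P I (runSteps w P I t) := by
  rw [runSteps_eq, Function.iterate_succ_apply', runSteps_eq]

theorem step_of_halt {w : ℕ} {P : Program} {I : DecoderInput} {s : Config}
    (h : nextInstr P s = .halt) : step w P I s = s := by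
  rw [step, h, exec]

theorem runSteps_of_halts {w : ℕ} {P : Program} {I : DecoderInput} {t : ℕ}
    (h : HaltsWithin w P I t) (k : ℕ) : runSteps w P I (t + k) = runSteps w P I t := by
  induction k with
  | zero => rfl
  | succ k ih => rw [← add_assoc, runSteps_succ, ih, step_of_halt h]

theorem HaltsWithin.mono {w : ℕ} {P : Program} {I : DecoderInput} {t t' : ℕ}
    (h : HaltsWithin w P I t) (ht : t ≤ t') : HaltsWithin w P I t' := by
  obtain ⟨k, rfl⟩ := Nat.exists_eq_add_of_le ht
  rw [HaltsWithin, runSteps_of_halts h]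
  exact h

theorem HaltsWithin.runSteps_eq {w : ℕ} {P : Program} {I : DecoderInput} {t t' : ℕ}
    (h : HaltsWithin w P I t) (h' : HaltsWithin w P I t') :
    runSteps w P I t = runSteps w P I t' := by
  rcases le_total t t' with ht | ht
  · obtain ⟨k, rfl⟩ := Nat.exists_eq_add_of_le ht
    rw [runSteps_of_halts h]
  · obtain ⟨k, rfl⟩ := Nat.exists_eq_add_of_le ht
    rw [runSteps_of_halts h']

/-! ### The decoder always halts -/

/-- What holds in the main loop of the decoder, whatever the input: the constants `1` and `0` stay
in registers `3` and `4`, and the fuel is positive where it is about to be used. -/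
structure LoopInvariant (s : Config) : Prop where
  one : s.reg 3 = 1
  zero : s.reg 4 = 0
  lower : 11 ≤ s.pc
  upper : s.pc ≤ 65
  fuel : s.pc = 13 → 0 < s.reg 11

/-- A bound on the number of steps until the decoder halts: the only backward jumps lead to the
beginning of the loop, where fuel is used, and to position `26`, two steps before it. -/
def ranking (s : Config) : ℕ :=
  100 * s.reg 11 + if s.pc ≤ 13 then 13 - s.pc else if s.pc = 26 ∨ s.pc = 27 then 30 - s.pc
    else 80 - s.pc

theorem ranking_step {w cF : ℕ} {I : DecoderInput} {s : Config}
    (hs : LoopInvariant s) (hf : s.reg 11 < 2 ^ w) :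
    nextInstr (decoder cF) s = .halt ∨
      (LoopInvariant (step w (decoder cF) I s) ∧
        (step w (decoder cF) I s).reg 11 < 2 ^ w ∧
        ranking (step w (decoder cF) I s) < ranking s) := by
  obtain ⟨pc, reg, mem, out⟩ := s
  obtain ⟨h3, h4, hl, hu, hfu⟩ := hs
  simp only at h3 h4 hl hu hfu hf
  have hsub : (reg 11 - 1) % 2 ^ w = reg 11 - 1 := Nat.mod_eq_of_lt (by omega)
  interval_cases pc <;>
    first
    | (left; rfl)
    | (right
       simp only [step, nextInstr, decoder, List.getD_cons_succ, List.getD_cons_zero,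
         exec, Config.write, ranking, h3, h4]
       refine ⟨⟨?_, ?_, ?_, ?_, ?_⟩, ?_, ?_⟩ <;> (try simp [h3, h4, hsub]) <;>
         (try split_ifs) <;> (try omega))

theorem exists_halt_le_ranking {w cF : ℕ} {I : DecoderInput} :
    ∀ (n : ℕ) (s : Config), LoopInvariant s → s.reg 11 < 2 ^ w → ranking s ≤ n →
      nextInstr (decoder cF) ((step w (decoder cF) I)^[n] s) = .halt := by
  intro n
  induction n with
  | zero =>
    intro s hs hf hn
    rcases ranking_step hs hf (cF := cF) (I := I) with h | ⟨_, _, h⟩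
    · exact h
    · omega
  | succ n ih =>
    intro s hs hf hn
    rw [Function.iterate_succ_apply]
    rcases ranking_step hs hf (cF := cF) (I := I) with h | ⟨h1, h2, h3⟩
    · rw [step_of_halt h, Function.iterate_fixed (step_of_halt h)]
      exact h
    · exact ih _ h1 h2 (by omega)

/-! ### What the decoder computes -/

/-- The machine started in `s` reaches a configuration with property `Q`. -/
def Reaches (w : ℕ) (P : Program) (I : DecoderInput) (Q : Config → Prop) (s : Config) : Prop :=
  ∃ m, Q ((step w P I)^[m] s)

theorem Reaches.of_step {w : ℕ} {P : Program} {I : DecoderInput} {Q : Config → Prop} {s : Config}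
    (h : Reaches w P I Q (step w P I s)) : Reaches w P I Q s := by
  obtain ⟨m, hm⟩ := h
  exact ⟨m + 1, by rwa [Function.iterate_succ_apply]⟩

theorem Reaches.refl {w : ℕ} {P : Program} {I : DecoderInput} {Q : Config → Prop} {s : Config}
    (h : Q s) : Reaches w P I Q s := ⟨0, h⟩

theorem Reaches.trans {w : ℕ} {P : Program} {I : DecoderInput} {Q Q' : Config → Prop} {s : Config}
    (h : Reaches w P I Q s) (h' : ∀ s, Q s → Reaches w P I Q' s) : Reaches w P I Q' s := by
  obtain ⟨m, hm⟩ := h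
  obtain ⟨m', hm'⟩ := h' _ hm
  exact ⟨m' + m, by rwa [Function.iterate_add_apply]⟩

/-- The registers that are fixed during the main loop, and the fuel, the height of the stack and
the mode. -/
structure Frame (I : DecoderInput) (r f sp mode : ℕ) (reg : ℕ → ℕ) : Prop where
  r0 : reg 0 = I.N
  r3 : reg 3 = 1
  r4 : reg 4 = 0
  r5 : reg 5 = r
  r7 : reg 7 = 1 + r * r
  r8 : reg 8 = 1 + r * r + r
  r9 : reg 9 = 1 + r * r + 2 * r
  r10 : reg 10 = 1 + r * r + 3 * r
  r11 : reg 11 = f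
  r12 : reg 12 = sp
  r13 : reg 13 = mode

/-- Initialization: the root of the heap is put on the stack. -/
theorem reaches_init {w cF r : ℕ} {I : DecoderInput} (hr : (I.rowList 0).length = r)
    (hw : 1 + r * r + 3 * r < 2 ^ w) (hF : cF * (r * r) < 2 ^ w) (hc : cF < 2 ^ w)
    (hN : I.N < 2 ^ w) :
    let s := runSteps w (decoder cF) I 11
    s.pc = 11 ∧ Frame I r (cF * (r * r)) 1 0 s.reg ∧ s.mem 0 = 1 ∧ s.out = [] := by
  have m1 : 1 % 2 ^ w = 1 := Nat.mod_eq_of_lt (by omega)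
  have m2 : r % 2 ^ w = r := Nat.mod_eq_of_lt (by omega)
  have m3 : (r * r) % 2 ^ w = r * r := Nat.mod_eq_of_lt (by omega)
  have m4 : (r * r + 1) % 2 ^ w = r * r + 1 := Nat.mod_eq_of_lt (by omega)
  have m5 : (r * r + 1 + r) % 2 ^ w = r * r + 1 + r := Nat.mod_eq_of_lt (by omega)
  have m6 : (r * r + 1 + r + r) % 2 ^ w = r * r + 1 + r + r := Nat.mod_eq_of_lt (by omega)
  have m7 : (r * r + 1 + r + r + r) % 2 ^ w = r * r + 1 + r + r + r :=
    Nat.mod_eq_of_lt (by omega)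
  have m8 : cF % 2 ^ w = cF := Nat.mod_eq_of_lt hc
  have m9 : (cF * (r * r)) % 2 ^ w = cF * (r * r) := Nat.mod_eq_of_lt hF
  have m10 : I.N % 2 ^ w = I.N := Nat.mod_eq_of_lt hN
  simp only [runSteps_eq, Function.iterate_succ_apply', Function.iterate_zero, id]
  simp [step, nextInstr, decoder, exec, Config.write, initConfig,
    m1, m2, m3, m4, m5, m6, m7, m8, m9, m10, hr]
  constructor <;> simp <;> omega

/-- The loop takes a node from the stack. -/
theorem reaches_pop {w cF r f sp : ℕ} {I : DecoderInput} {s : Config} (hpc : s.pc = 11)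
    (hs : Frame I r (f + 1) (sp + 1) 0 s.reg) (hf : f < 2 ^ w) (hsp : sp < 2 ^ w)
    (hv : s.mem sp < 2 ^ w) :
    Reaches w (decoder cF) I (fun s' => s'.pc = (if s.mem sp < I.N then 33 else 20) ∧
      Frame I r f sp 0 s'.reg ∧ s'.reg 14 = s.mem sp ∧ s'.mem = s.mem ∧ s'.out = s.out) s := by
  obtain ⟨pc, reg, mem, out⟩ := s
  obtain ⟨r0, r3, r4, r5, r7, r8, r9, r10, r11, r12, r13⟩ := hs
  simp only at *
  subst hpc
  have m1 := Nat.mod_eq_of_lt hf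
  have m2 := Nat.mod_eq_of_lt hsp
  have m3 := Nat.mod_eq_of_lt hv
  iterate 7
    refine Reaches.of_step ?_
    simp [step, nextInstr, decoder, exec, Config.write, r0, r3, r4, r11,
      r12, r13, m1, m2, m3]
  refine Reaches.refl ⟨rfl, ?_, ?_⟩
  · constructor <;> simp [*]
  · simp

theorem Reaches.of_instr {w : ℕ} {P : Program} {I : DecoderInput} {Q : Config → Prop} {s : Config}
    (i : Instr) (hi : nextInstr P s = i) (h : Reaches w P I Q (exec w I s i)) :
    Reaches w P I Q s :=
  Reaches.of_step (by rwa [step, hi])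

theorem outcomeAt_eq_zero_or_one (I : DecoderInput) (i : ℕ) :
    I.outcomeAt i = 0 ∨ I.outcomeAt i = 1 := by
  unfold DecoderInput.outcomeAt
  split_ifs
  · cases I.y _ <;> simp
  · simp

/-- At a leaf, the machine prepares to check the item. -/
theorem reaches_leaf {w cF r f sp v : ℕ} {I : DecoderInput} {s : Config} (hpc : s.pc = 20)
    (hs : Frame I r f sp 0 s.reg) (h14 : s.reg 14 = v) (hv : v < 2 ^ w)
    (hlen : (I.colList (v - I.N)).length < 2 ^ w) (hw : 1 < 2 ^ w) :
    Reaches w (decoder cF) I (fun s' => s'.pc = 11 ∧ Frame I r f sp 1 s'.reg ∧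
      s'.reg 15 = v - I.N ∧ s'.reg 16 = (I.colList (v - I.N)).length ∧
      s'.mem = s.mem ∧ s'.out = s.out) s := by
  obtain ⟨pc, reg, mem, out⟩ := s
  obtain ⟨r0, r3, r4, r5, r7, r8, r9, r10, r11, r12, r13⟩ := hs
  simp only at *
  subst hpc
  have m1 : (v - I.N) % 2 ^ w = v - I.N := Nat.mod_eq_of_lt (by omega)
  have m2 := Nat.mod_eq_of_lt hlen
  have m3 := Nat.mod_eq_of_lt hw
  iterate 4
    refine Reaches.of_step ?_
    simp [step, nextInstr, decoder, exec, Config.write, r0, r3, r4, h14, m1, m2, m3]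
  refine Reaches.refl ⟨rfl, ?_, ?_⟩
  · constructor <;> simp [*]
  · simp

/-- In the checking mode, an item all of whose tests have been read is output. -/
theorem reaches_check_zero {w cF r f sp j : ℕ} {I : DecoderInput} {s : Config} (hpc : s.pc = 11)
    (hs : Frame I r (f + 1) sp 1 s.reg) (hf : f < 2 ^ w) (h15 : s.reg 15 = j)
    (h16 : s.reg 16 = 0) :
    Reaches w (decoder cF) I (fun s' => s'.pc = 11 ∧ Frame I r f sp 0 s'.reg ∧
      s'.mem = s.mem ∧ s'.out = s.out ++ [j]) s := by
  obtain ⟨pc, reg, mem, out⟩ := s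
  obtain ⟨r0, r3, r4, r5, r7, r8, r9, r10, r11, r12, r13⟩ := hs
  simp only at *
  subst hpc
  have m1 := Nat.mod_eq_of_lt hf
  iterate 7
    refine Reaches.of_step ?_
    simp [step, nextInstr, decoder, exec, Config.write, r3, r4, r11, r13, h15, h16, m1]
  refine Reaches.refl ⟨rfl, ?_, ?_⟩
  · constructor <;> simp [*]
  · simp

/-- In the checking mode, a positive test of the item leads to its next test. -/
theorem reaches_check_pos {w cF r f sp j p : ℕ} {I : DecoderInput} {s : Config} (hpc : s.pc = 11)
    (hs : Frame I r (f + 1) sp 1 s.reg) (hf : f < 2 ^ w) (h15 : s.reg 15 = j)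
    (h16 : s.reg 16 = p + 1) (hp : p < 2 ^ w) (hi : (I.colList j).getD p 0 < 2 ^ w)
    (hy : I.outcomeAt ((I.colList j).getD p 0) = 1) (hw : 1 < 2 ^ w) :
    Reaches w (decoder cF) I (fun s' => s'.pc = 11 ∧ Frame I r f sp 1 s'.reg ∧
      s'.reg 15 = j ∧ s'.reg 16 = p ∧ s'.mem = s.mem ∧ s'.out = s.out) s := by
  obtain ⟨pc, reg, mem, out⟩ := s
  obtain ⟨r0, r3, r4, r5, r7, r8, r9, r10, r11, r12, r13⟩ := hs
  simp only [List.getD_eq_getElem?_getD] at *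
  subst hpc
  have m1 := Nat.mod_eq_of_lt hf
  have m2 := Nat.mod_eq_of_lt hp
  have m3 := Nat.mod_eq_of_lt hi
  have m4 := Nat.mod_eq_of_lt hw
  iterate 8
    refine Reaches.of_step ?_
    simp [step, nextInstr, decoder, exec, Config.write, r3, r4, r11, r13, h15, h16, m1, m2, m3,
      hy, m4]
  refine Reaches.refl ⟨rfl, ?_, ?_⟩
  · constructor <;> simp [*]
  · simp [*]

/-- In the checking mode, a negative test of the item ends the check without output. -/
theorem reaches_check_neg {w cF r f sp j p : ℕ} {I : DecoderInput} {s : Config} (hpc : s.pc = 11)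
    (hs : Frame I r (f + 1) sp 1 s.reg) (hf : f < 2 ^ w) (h15 : s.reg 15 = j)
    (h16 : s.reg 16 = p + 1) (hp : p < 2 ^ w) (hi : (I.colList j).getD p 0 < 2 ^ w)
    (hy : I.outcomeAt ((I.colList j).getD p 0) = 0) :
    Reaches w (decoder cF) I (fun s' => s'.pc = 11 ∧ Frame I r f sp 0 s'.reg ∧
      s'.mem = s.mem ∧ s'.out = s.out) s := by
  obtain ⟨pc, reg, mem, out⟩ := s
  obtain ⟨r0, r3, r4, r5, r7, r8, r9, r10, r11, r12, r13⟩ := hs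
  simp only [List.getD_eq_getElem?_getD] at *
  subst hpc
  have m1 := Nat.mod_eq_of_lt hf
  have m2 := Nat.mod_eq_of_lt hp
  have m3 := Nat.mod_eq_of_lt hi
  iterate 11
    refine Reaches.of_step ?_
    simp [step, nextInstr, decoder, exec, Config.write, r3, r4, r11, r13, h15, h16, m1, m2, m3,
      hy]
  refine Reaches.refl ⟨rfl, ?_, ?_⟩
  · constructor <;> simp [*]
  · simp [*]

/-- The entries of a column at which the lookup table stores the test `x = (x / r) * r + x % r`
in the blocks of rows that begin at `b` and `b + r`. -/
def Stores (I : DecoderInput) (r v p b x : ℕ) : Prop :=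
  (I.colList v).getD p 0 = b + x / r ∧ (I.colList v).getD (p + 1) 0 = b + r + x % r

/-- At an inner node, the second test of the node is looked up and read. -/
theorem reaches_second_test {w cF r f sp v p x : ℕ} {I : DecoderInput} {s : Config}
    (hpc : s.pc = 33) (hs : Frame I r f sp 0 s.reg) (h14 : s.reg 14 = v)
    (hlen : (I.colList v).length = p + 2) (hp : p + 2 < 2 ^ w)
    (hst : Stores I r v p (1 + r * r + 2 * r) x) (hx : x < r * r) (hw : 1 + r * r + 4 * r < 2 ^ w) :
    Reaches w (decoder cF) I (fun s' =>
      s'.pc = (if 0 < I.outcomeAt (1 + x) then 46 else 11) ∧ Frame I r f sp 0 s'.reg ∧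
      s'.reg 14 = v ∧ s'.reg 16 = p ∧ s'.mem = s.mem ∧ s'.out = s.out) s := by
  obtain ⟨pc, reg, mem, out⟩ := s
  obtain ⟨r0, r3, r4, r5, r7, r8, r9, r10, r11, r12, r13⟩ := hs
  obtain ⟨hs1, hs2⟩ := hst
  simp only at *
  subst hpc
  have hr : 0 < r := Nat.pos_of_ne_zero (by rintro rfl; simp at hx)
  have hx1 : x / r < r := Nat.div_lt_of_lt_mul hx
  have hx2 : x % r < r := Nat.mod_lt _ hr
  have e1 : p + 2 - 1 = p + 1 := rfl
  have e4 : 1 + r * r + 2 * r + r + x % r - (1 + r * r + 3 * r) = x % r := by omega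
  have e6 : 1 + r * r + 2 * r + x / r - (1 + r * r + 2 * r) = x / r := Nat.add_sub_cancel_left _ _
  have e8 : x / r * r + x % r = x := by rw [mul_comm]; exact Nat.div_add_mod x r
  have m0 := Nat.mod_eq_of_lt hp
  have m1 : (p + 1) % 2 ^ w = p + 1 := Nat.mod_eq_of_lt (by omega)
  have m2 : p % 2 ^ w = p := Nat.mod_eq_of_lt (by omega)
  have m4 : (1 + r * r + 2 * r + r + x % r) % 2 ^ w = 1 + r * r + 2 * r + r + x % r :=
    Nat.mod_eq_of_lt (by omega)
  have m5 : x % r % 2 ^ w = x % r := Nat.mod_eq_of_lt (by omega)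
  have m6 : (1 + r * r + 2 * r + x / r) % 2 ^ w = 1 + r * r + 2 * r + x / r := Nat.mod_eq_of_lt (by omega)
  have m7 : (x / r) % 2 ^ w = x / r := Nat.mod_eq_of_lt (by omega)
  have m8 : (x / r * r) % 2 ^ w = x / r * r := Nat.mod_eq_of_lt (by omega)
  have m9 : x % 2 ^ w = x := Nat.mod_eq_of_lt (by omega)
  have m10 : (x + 1) % 2 ^ w = 1 + x := by rw [Nat.mod_eq_of_lt (by omega)]; omega
  have hy := outcomeAt_eq_zero_or_one I (1 + x)
  have my : I.outcomeAt (1 + x) % 2 ^ w = I.outcomeAt (1 + x) := Nat.mod_eq_of_lt (by omega)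
  refine Reaches.of_instr (.colLen 16 14) rfl ?_
  simp only [exec, Config.write, Function.update_self, Function.update_of_ne, ne_eq,
    Nat.reduceEqDiff, not_false_eq_true, Nat.reduceAdd, h14, hlen, m0]
  refine Reaches.of_instr (.sub 16 16 3) rfl ?_
  simp only [exec, Config.write, Function.update_self, Function.update_of_ne, ne_eq,
    Nat.reduceEqDiff, not_false_eq_true, Nat.reduceAdd, r3, Nat.add_sub_cancel, e1, m1]
  refine Reaches.of_instr (.colGet 17 14 16) rfl ?_
  simp only [exec, Config.write, Function.update_self, Function.update_of_ne, ne_eq,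
    Nat.reduceEqDiff, not_false_eq_true, Nat.reduceAdd, h14, hs2, m4]
  refine Reaches.of_instr (.sub 17 17 10) rfl ?_
  simp only [exec, Config.write, Function.update_self, Function.update_of_ne, ne_eq,
    Nat.reduceEqDiff, not_false_eq_true, Nat.reduceAdd, r10, e4, m5]
  refine Reaches.of_instr (.sub 16 16 3) rfl ?_
  simp only [exec, Config.write, Function.update_self, Function.update_of_ne, ne_eq,
    Nat.reduceEqDiff, not_false_eq_true, Nat.reduceAdd, r3, Nat.add_sub_cancel, m2]
  refine Reaches.of_instr (.colGet 18 14 16) rfl ?_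
  simp only [exec, Config.write, Function.update_self, Function.update_of_ne, ne_eq,
    Nat.reduceEqDiff, not_false_eq_true, Nat.reduceAdd, h14, hs1, m6]
  refine Reaches.of_instr (.sub 18 18 9) rfl ?_
  simp only [exec, Config.write, Function.update_self, Function.update_of_ne, ne_eq,
    Nat.reduceEqDiff, not_false_eq_true, Nat.reduceAdd, r9, e6, m7]
  refine Reaches.of_instr (.mul 18 18 5) rfl ?_
  simp only [exec, Config.write, Function.update_self, Function.update_of_ne, ne_eq,
    Nat.reduceEqDiff, not_false_eq_true, Nat.reduceAdd, r5, m8]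
  refine Reaches.of_instr (.add 18 18 17) rfl ?_
  simp only [exec, Config.write, Function.update_self, Function.update_of_ne, ne_eq,
    Nat.reduceEqDiff, not_false_eq_true, Nat.reduceAdd, e8, m9]
  refine Reaches.of_instr (.add 18 18 3) rfl ?_
  simp only [exec, Config.write, Function.update_self, Function.update_of_ne, ne_eq,
    Nat.reduceEqDiff, not_false_eq_true, Nat.reduceAdd, r3, m10]
  refine Reaches.of_instr (.outcome 18 18) rfl ?_
  simp only [exec, Config.write, Function.update_self, Function.update_of_ne, ne_eq,
    Nat.reduceEqDiff, not_false_eq_true, Nat.reduceAdd, my]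
  rcases hy with hy | hy
  · refine Reaches.of_instr (.jumpLT 4 18 46) rfl ?_
    simp only [exec, Function.update_self, Function.update_of_ne, ne_eq, Nat.reduceEqDiff,
      not_false_eq_true, Nat.reduceAdd, hy, r4, lt_irrefl, if_false]
    refine Reaches.of_instr (.jumpLT 4 3 11) rfl ?_
    simp only [exec, Function.update_of_ne, ne_eq, Nat.reduceEqDiff,
      not_false_eq_true, r3, r4, zero_lt_one, if_true]
    refine Reaches.refl ⟨rfl, ?_, ?_⟩
    · constructor <;> simp [*]
    · simp [*]
  · refine Reaches.of_instr (.jumpLT 4 18 46) rfl ?_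
    simp only [exec, Function.update_self, Function.update_of_ne, ne_eq, Nat.reduceEqDiff,
      not_false_eq_true, hy, r4, zero_lt_one, if_true]
    refine Reaches.refl ⟨rfl, ?_, ?_⟩
    · constructor <;> simp [*]
    · simp [*]

/-- At an inner node, the first test of the node is looked up and read. -/
theorem reaches_first_test {w cF r f sp v p x : ℕ} {I : DecoderInput} {s : Config}
    (hpc : s.pc = 46) (hs : Frame I r f sp 0 s.reg) (h14 : s.reg 14 = v)
    (h16 : s.reg 16 = p + 2) (hp : p + 2 < 2 ^ w)
    (hst : Stores I r v p (1 + r * r) x) (hx : x < r * r) (hw : 1 + r * r + 4 * r < 2 ^ w) :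
    Reaches w (decoder cF) I (fun s' =>
      s'.pc = (if 0 < I.outcomeAt (1 + x) then 58 else 11) ∧ Frame I r f sp 0 s'.reg ∧
      s'.reg 14 = v ∧ s'.reg 16 = p ∧ s'.mem = s.mem ∧ s'.out = s.out) s := by
  obtain ⟨pc, reg, mem, out⟩ := s
  obtain ⟨r0, r3, r4, r5, r7, r8, r9, r10, r11, r12, r13⟩ := hs
  obtain ⟨hs1, hs2⟩ := hst
  simp only at *
  subst hpc
  have hr : 0 < r := Nat.pos_of_ne_zero (by rintro rfl; simp at hx)
  have hx1 : x / r < r := Nat.div_lt_of_lt_mul hx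
  have hx2 : x % r < r := Nat.mod_lt _ hr
  have e1 : p + 2 - 1 = p + 1 := rfl
  have e4 : 1 + r * r + r + x % r - (1 + r * r + r) = x % r := by omega
  have e6 : 1 + r * r + x / r - (1 + r * r) = x / r := Nat.add_sub_cancel_left _ _
  have e8 : x / r * r + x % r = x := by rw [mul_comm]; exact Nat.div_add_mod x r
  have m0 := Nat.mod_eq_of_lt hp
  have m1 : (p + 1) % 2 ^ w = p + 1 := Nat.mod_eq_of_lt (by omega)
  have m2 : p % 2 ^ w = p := Nat.mod_eq_of_lt (by omega)
  have m4 : (1 + r * r + r + x % r) % 2 ^ w = 1 + r * r + r + x % r :=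
    Nat.mod_eq_of_lt (by omega)
  have m5 : x % r % 2 ^ w = x % r := Nat.mod_eq_of_lt (by omega)
  have m6 : (1 + r * r + x / r) % 2 ^ w = 1 + r * r + x / r := Nat.mod_eq_of_lt (by omega)
  have m7 : (x / r) % 2 ^ w = x / r := Nat.mod_eq_of_lt (by omega)
  have m8 : (x / r * r) % 2 ^ w = x / r * r := Nat.mod_eq_of_lt (by omega)
  have m9 : x % 2 ^ w = x := Nat.mod_eq_of_lt (by omega)
  have m10 : (x + 1) % 2 ^ w = 1 + x := by rw [Nat.mod_eq_of_lt (by omega)]; omega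
  have hy := outcomeAt_eq_zero_or_one I (1 + x)
  have my : I.outcomeAt (1 + x) % 2 ^ w = I.outcomeAt (1 + x) := Nat.mod_eq_of_lt (by omega)
  refine Reaches.of_instr (.sub 16 16 3) rfl ?_
  simp only [exec, Config.write, Function.update_self, Function.update_of_ne, ne_eq,
    Nat.reduceEqDiff, not_false_eq_true, Nat.reduceAdd, h16, r3, Nat.add_sub_cancel, e1, m1]
  refine Reaches.of_instr (.colGet 17 14 16) rfl ?_
  simp only [exec, Config.write, Function.update_self, Function.update_of_ne, ne_eq,
    Nat.reduceEqDiff, not_false_eq_true, Nat.reduceAdd, h14, h16, hs2, m4]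
  refine Reaches.of_instr (.sub 17 17 8) rfl ?_
  simp only [exec, Config.write, Function.update_self, Function.update_of_ne, ne_eq,
    Nat.reduceEqDiff, not_false_eq_true, Nat.reduceAdd, r8, e4, m5]
  refine Reaches.of_instr (.sub 16 16 3) rfl ?_
  simp only [exec, Config.write, Function.update_self, Function.update_of_ne, ne_eq,
    Nat.reduceEqDiff, not_false_eq_true, Nat.reduceAdd, h16, r3, Nat.add_sub_cancel, m2]
  refine Reaches.of_instr (.colGet 18 14 16) rfl ?_
  simp only [exec, Config.write, Function.update_self, Function.update_of_ne, ne_eq,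
    Nat.reduceEqDiff, not_false_eq_true, Nat.reduceAdd, h14, hs1, m6]
  refine Reaches.of_instr (.sub 18 18 7) rfl ?_
  simp only [exec, Config.write, Function.update_self, Function.update_of_ne, ne_eq,
    Nat.reduceEqDiff, not_false_eq_true, Nat.reduceAdd, r7, e6, m7]
  refine Reaches.of_instr (.mul 18 18 5) rfl ?_
  simp only [exec, Config.write, Function.update_self, Function.update_of_ne, ne_eq,
    Nat.reduceEqDiff, not_false_eq_true, Nat.reduceAdd, r5, m8]
  refine Reaches.of_instr (.add 18 18 17) rfl ?_
  simp only [exec, Config.write, Function.update_self, Function.update_of_ne, ne_eq,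
    Nat.reduceEqDiff, not_false_eq_true, Nat.reduceAdd, e8, m9]
  refine Reaches.of_instr (.add 18 18 3) rfl ?_
  simp only [exec, Config.write, Function.update_self, Function.update_of_ne, ne_eq,
    Nat.reduceEqDiff, not_false_eq_true, Nat.reduceAdd, r3, m10]
  refine Reaches.of_instr (.outcome 18 18) rfl ?_
  simp only [exec, Config.write, Function.update_self, Function.update_of_ne, ne_eq,
    Nat.reduceEqDiff, not_false_eq_true, Nat.reduceAdd, my]
  rcases hy with hy | hy
  · refine Reaches.of_instr (.jumpLT 4 18 58) rfl ?_
    simp only [exec, Function.update_self, Function.update_of_ne, ne_eq, Nat.reduceEqDiff,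
      not_false_eq_true, Nat.reduceAdd, hy, r4, lt_irrefl, if_false]
    refine Reaches.of_instr (.jumpLT 4 3 11) rfl ?_
    simp only [exec, Function.update_of_ne, ne_eq, Nat.reduceEqDiff,
      not_false_eq_true, r3, r4, zero_lt_one, if_true]
    refine Reaches.refl ⟨rfl, ?_, ?_⟩
    · constructor <;> simp [*]
    · simp [*]
  · refine Reaches.of_instr (.jumpLT 4 18 58) rfl ?_
    simp only [exec, Function.update_self, Function.update_of_ne, ne_eq, Nat.reduceEqDiff,
      not_false_eq_true, hy, r4, zero_lt_one, if_true]
    refine Reaches.refl ⟨rfl, ?_, ?_⟩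
    · constructor <;> simp [*]
    · simp [*]

/-- At an inner node that passes both tests, the children are put on the stack. -/
theorem reaches_push {w cF r f sp v : ℕ} {I : DecoderInput} {s : Config}
    (hpc : s.pc = 58) (hs : Frame I r f sp 0 s.reg) (h14 : s.reg 14 = v)
    (hv : 2 * v + 1 < 2 ^ w) (hsp : sp + 2 < 2 ^ w) :
    Reaches w (decoder cF) I (fun s' => s'.pc = 11 ∧ Frame I r f (sp + 2) 0 s'.reg ∧
      s'.mem = Function.update (Function.update s.mem sp (2 * v)) (sp + 1) (2 * v + 1) ∧
      s'.out = s.out) s := by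
  obtain ⟨pc, reg, mem, out⟩ := s
  obtain ⟨r0, r3, r4, r5, r7, r8, r9, r10, r11, r12, r13⟩ := hs
  simp only at *
  subst hpc
  have m1 : (v + v) % 2 ^ w = 2 * v := by rw [Nat.mod_eq_of_lt (by omega)]; omega
  have m2 : (2 * v + 1) % 2 ^ w = 2 * v + 1 := Nat.mod_eq_of_lt hv
  have m3 : (sp + 1) % 2 ^ w = sp + 1 := Nat.mod_eq_of_lt (by omega)
  have m4 : (sp + 1 + 1) % 2 ^ w = sp + 2 := by rw [Nat.mod_eq_of_lt (by omega)]
  refine Reaches.of_instr (.add 14 14 14) rfl ?_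
  simp [exec, Config.write, r3, r4, r12, h14, m1, m2, m3, m4]
  refine Reaches.of_instr (.store 12 14) rfl ?_
  simp [exec, Config.write, r3, r4, r12, h14, m1, m2, m3, m4]
  refine Reaches.of_instr (.add 12 12 3) rfl ?_
  simp [exec, Config.write, r3, r4, r12, h14, m1, m2, m3, m4]
  refine Reaches.of_instr (.add 14 14 3) rfl ?_
  simp [exec, Config.write, r3, r4, r12, h14, m1, m2, m3, m4]
  refine Reaches.of_instr (.store 12 14) rfl ?_
  simp [exec, Config.write, r3, r4, r12, h14, m1, m2, m3, m4]
  refine Reaches.of_instr (.add 12 12 3) rfl ?_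
  simp [exec, Config.write, r3, r4, r12, h14, m1, m2, m3, m4]
  refine Reaches.of_instr (.jumpLT 4 3 11) rfl ?_
  simp [exec, Config.write, r3, r4, r12, h14, m1, m2, m3, m4]
  refine Reaches.refl ⟨rfl, ?_, ?_⟩
  · constructor <;> simp [*]
  · simp

/-- The check of item `j`, of which the tests at the positions below `p` have not been read. -/
theorem reaches_check {w cF r sp j : ℕ} {I : DecoderInput} (hw : 1 < 2 ^ w)
    (hcol : ∀ p, (I.colList j).getD p 0 < 2 ^ w) :
    ∀ (p f : ℕ) (s : Config), s.pc = 11 → Frame I r f sp 1 s.reg → s.reg 15 = j →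
      s.reg 16 = p → p < 2 ^ w → p + 1 ≤ f → f < 2 ^ w →
      Reaches w (decoder cF) I (fun s' => s'.pc = 11 ∧ (∃ f', f ≤ f' + (p + 1) ∧ f' ≤ f ∧
        Frame I r f' sp 0 s'.reg) ∧ s'.mem = s.mem ∧ s'.out = s.out ++
          if ∀ q < p, I.outcomeAt ((I.colList j).getD q 0) = 1 then [j] else []) s := by
  intro p
  induction p with
  | zero =>
    intro f s hpc hs h15 h16 _ hf hfw
    obtain ⟨f, rfl⟩ : ∃ f', f = f' + 1 := ⟨f - 1, by omega⟩
    refine (reaches_check_zero hpc hs (by omega) h15 h16).trans ?_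
    rintro s' ⟨h1, h2, h3, h4⟩
    exact Reaches.refl ⟨h1, ⟨f, by omega, by omega, h2⟩, h3, by simp [h4]⟩
  | succ p ih =>
    intro f s hpc hs h15 h16 hp hf hfw
    obtain ⟨f, rfl⟩ : ∃ f', f = f' + 1 := ⟨f - 1, by omega⟩
    rcases outcomeAt_eq_zero_or_one I ((I.colList j).getD p 0) with hy | hy
    · refine (reaches_check_neg hpc hs (by omega) h15 h16 (by omega) (hcol p) hy).trans ?_
      rintro s' ⟨h1, h2, h3, h4⟩
      refine Reaches.refl ⟨h1, ⟨f, by omega, by omega, h2⟩, h3, ?_⟩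
      rw [if_neg, h4, List.append_nil]
      intro h
      have := h p (by omega)
      omega
    · refine (reaches_check_pos hpc hs (by omega) h15 h16 (by omega) (hcol p) hy hw).trans ?_
      rintro s' ⟨h1, h2, h3, h4, h5, h6⟩
      refine (ih f s' h1 h2 h3 h4 (by omega) (by omega) (by omega)).trans ?_
      rintro s'' ⟨k1, ⟨f', k2, k3, k4⟩, k5, k6⟩
      refine Reaches.refl ⟨k1, ⟨f', by omega, by omega, k4⟩, k5.trans h5, ?_⟩
      rw [k6, h6]
      congr 1
      refine if_congr ⟨fun h q hq => ?_, fun h q hq => h q (by omega)⟩ rfl rfl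
      rcases Nat.lt_succ_iff_lt_or_eq.mp hq with hq | rfl
      exacts [h q hq, hy]

/-- The stack occupies the cells below its height, the top of the list being the topmost cell. -/
def StackIn (mem : ℕ → ℕ) : List ℕ → Prop
  | [] => True
  | v :: l => mem l.length = v ∧ StackIn mem l

theorem StackIn.update {mem : ℕ → ℕ} {a x : ℕ} :
    ∀ {l : List ℕ}, StackIn mem l → l.length ≤ a → StackIn (Function.update mem a x) l
  | [], _, _ => trivial
  | v :: l, h, ha => by
    simp only [List.length_cons] at ha
    exact ⟨by rw [Function.update_of_ne (by omega)]; exact h.1, h.2.update (by omega)⟩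

/-- The column `v` of the test matrix ends with the entries of the lookup table that store the tests
`g v 0` and `g v 1` of node `v`; `L` exceeds the length of the column. -/
structure ColumnTable (I : DecoderInput) (r L : ℕ) (g : ℕ → Fin 2 → ℕ) (v : ℕ) : Prop where
  lt : ∀ e, g v e < r * r
  mem_lt : ∀ i ∈ I.colList v, i < 1 + r * r + 4 * r
  stores : ∃ p, (I.colList v).length = p + 4 ∧ p + 6 ≤ L ∧ Stores I r v p (1 + r * r) (g v 0) ∧
    Stores I r v (p + 2) (1 + r * r + 2 * r) (g v 1)

/-- Both tests of node `v` are positive. -/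
def observedPass (I : DecoderInput) (g : ℕ → Fin 2 → ℕ) (v : ℕ) : Bool :=
  decide (∀ e, I.outcomeAt (1 + g v e) = 1)

/-- The item of leaf `v`, if all its tests are positive. -/
def leafOutput (I : DecoderInput) (v : ℕ) : List ℕ :=
  if ∀ i ∈ I.colList (v - I.N), I.outcomeAt i = 1 then [v - I.N] else []

/-- The items output by the exploration of the subtree below `v`. -/
def exploreOutput (I : DecoderInput) (g : ℕ → Fin 2 → ℕ) : ℕ → ℕ → List ℕ
  | 0, v => leafOutput I v
  | n + 1, v => if I.N ≤ v then leafOutput I v else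
      if observedPass I g v then exploreOutput I g n (2 * v + 1) ++ exploreOutput I g n (2 * v)
      else []

/-- The machine is at the beginning of its main loop, in the exploring mode. -/
structure AtLoop (I : DecoderInput) (r f : ℕ) (stack out : List ℕ) (s : Config) : Prop where
  pc : s.pc = 11
  frame : Frame I r f stack.length 0 s.reg
  stackIn : StackIn s.mem stack
  out : s.out = out

theorem reaches_leafOutput {w cF r L f v : ℕ} {I : DecoderInput} {stack out : List ℕ} {s : Config}
    {g : ℕ → Fin 2 → ℕ} (hw : 1 + r * r + 4 * r < 2 ^ w) (htab : ColumnTable I r L g (v - I.N))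
    (hL : L ≤ f) (hf : f < 2 ^ w) (hN : I.N ≤ v) (hv : v < 2 ^ w) (hst : stack.length < 2 ^ w)
    (hs : AtLoop I r f (v :: stack) out s) :
    Reaches w (decoder cF) I (fun s' => ∃ f', f ≤ f' + L ∧ f' ≤ f ∧
      AtLoop I r f' stack (out ++ leafOutput I v) s') s := by
  obtain ⟨h1, h2, ⟨h3, h3'⟩, h4⟩ := hs
  obtain ⟨p, hp, hpL, -⟩ := htab.stores
  obtain ⟨f, rfl⟩ : ∃ f', f = f' + 1 := ⟨f - 1, by omega⟩
  have hr : 0 < r := by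
    rcases Nat.eq_zero_or_pos r with rfl | h
    · simpa using htab.lt 0
    · exact h
  refine (reaches_pop h1 h2 (by omega) (by omega) (by omega)).trans ?_
  rintro s1 ⟨a1, a2, a3, a4, a5⟩
  rw [h3, if_neg (by omega)] at a1
  rw [h3] at a3
  refine (reaches_leaf a1 a2 a3 hv (by omega) (by omega)).trans ?_
  rintro s2 ⟨b1, b2, b3, b4, b5, b6⟩
  have hcol : ∀ q, (I.colList (v - I.N)).getD q 0 < 2 ^ w := by
    intro q
    rw [List.getD_eq_getElem?_getD]
    rcases lt_or_ge q (I.colList (v - I.N)).length with hq | hq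
    · rw [List.getElem?_eq_getElem hq, Option.getD_some]
      exact (htab.mem_lt _ (List.getElem_mem hq)).trans hw
    · rw [List.getElem?_eq_none hq, Option.getD_none]
      omega
  refine (reaches_check (by omega) hcol _ f s2 b1 b2 b3 b4 (by omega) (by omega) (by omega)).trans
    ?_
  rintro s3 ⟨c1, ⟨f', c2, c3, c4⟩, c5, c6⟩
  refine Reaches.refl ⟨f', by omega, by omega, c1, c4, by rw [c5, b5, a4]; exact h3', ?_⟩
  rw [c6, b6, a5, h4, leafOutput]
  congr 1
  refine if_congr ⟨fun h i hi => ?_, fun h q hq => ?_⟩ rfl rfl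
  · obtain ⟨q, hq, rfl⟩ := List.getElem_of_mem hi
    have := h q hq
    rwa [List.getD_eq_getElem?_getD, List.getElem?_eq_getElem hq, Option.getD_some] at this
  · rw [List.getD_eq_getElem?_getD, List.getElem?_eq_getElem hq, Option.getD_some]
    exact h _ (List.getElem_mem hq)

set_option maxHeartbeats 1000000 in
/-- The exploration of the subtree below the top of the stack. -/
theorem reaches_exploreOutput {w cF r L d : ℕ} {I : DecoderInput} {g : ℕ → Fin 2 → ℕ}
    (hw : 1 + r * r + 4 * r < 2 ^ w) (htab : ∀ v < I.N, ColumnTable I r L g v)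
    (hd : 2 ^ d ≤ 2 * I.N) (hw' : 4 * I.N + d + L < 2 ^ w) :
    ∀ (n v f : ℕ) (stack out : List ℕ) (s : Config), I.N ≤ v * 2 ^ n →
      (v + 1) * 2 ^ n ≤ 2 ^ (d + 1) → v < 2 * I.N → 0 < v →
      exploreCost I.N L (observedPass I g) n v ≤ f → f < 2 ^ w →
      stack.length + n ≤ d → AtLoop I r f (v :: stack) out s →
      Reaches w (decoder cF) I (fun s' => ∃ f', f ≤ f' + exploreCost I.N L (observedPass I g) n v ∧
        f' ≤ f ∧ AtLoop I r f' stack (out ++ exploreOutput I g n v) s') s := by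
  intro n
  induction n with
  | zero =>
    intro v f stack out s h1 h2 h3 h0 h4 h5 h6 hs
    simp only [exploreCost] at h4 ⊢
    simp only [exploreOutput]
    exact reaches_leafOutput hw (htab _ (by omega)) h4 h5 (by omega) (by omega) (by omega) hs
  | succ n ih =>
    intro v f stack out s h1 h2 h3 h0 h4 h5 h6 hs
    by_cases hN : I.N ≤ v
    · simp only [exploreCost, exploreOutput, hN, if_true] at h4 ⊢
      exact reaches_leafOutput hw (htab _ (by omega)) h4 h5 hN (by omega) (by omega) hs
    simp only [exploreCost, exploreOutput, hN, if_false] at h4 ⊢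
    obtain ⟨f, rfl⟩ : ∃ f', f = f' + 1 := ⟨f - 1, by omega⟩
    obtain ⟨p, hp, hpL, hst0, hst1⟩ := (htab v (by omega)).stores
    have hlt := (htab v (by omega)).lt
    have hpc := hs.pc
    have hfr := hs.frame
    have hst := hs.stackIn
    have hout := hs.out
    refine (reaches_pop hpc hfr (by omega) (by omega) (by rw [hst.1]; omega)).trans ?_
    rintro s1 ⟨a1, a2, a3, a4, a5⟩
    rw [hst.1, if_pos (by omega)] at a1
    rw [hst.1] at a3
    refine (reaches_second_test a1 a2 a3 hp (by omega) hst1 (hlt 1) hw).trans ?_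
    rintro s2 ⟨b1, b2, b3, b4, b5, b6⟩
    have hfail : ∀ s' : Config, s'.pc = 11 → Frame I r f stack.length 0 s'.reg → s'.mem = s.mem →
        s'.out = s.out → observedPass I g v = false →
        Reaches w (decoder cF) I (fun s' => ∃ f', f + 1 ≤ f' + (1 + if observedPass I g v = true then
          exploreCost I.N L (observedPass I g) n (2 * v) +
            exploreCost I.N L (observedPass I g) n (2 * v + 1) else 0) ∧ f' ≤ f + 1 ∧
          AtLoop I r f' stack (out ++ if observedPass I g v = true then
            exploreOutput I g n (2 * v + 1) ++ exploreOutput I g n (2 * v) else []) s') s' := by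
      intro s' k1 k2 k3 k4 k5
      refine Reaches.refl ⟨f, by omega, by omega, k1, k2, by rw [k3]; exact hst.2, ?_⟩
      rw [k5, k4, hout]
      simp
    rcases outcomeAt_eq_zero_or_one I (1 + g v 1) with hy | hy
    · rw [hy, if_neg (by omega)] at b1
      refine hfail s2 b1 b2 (b5.trans a4) (b6.trans a5) ?_
      refine decide_eq_false fun h => ?_
      have := h 1
      omega
    rw [hy, if_pos (by omega)] at b1
    refine (reaches_first_test b1 b2 b3 b4 (by omega) hst0 (hlt 0) hw).trans ?_
    rintro s3 ⟨c1, c2, c3, c4, c5, c6⟩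
    rcases outcomeAt_eq_zero_or_one I (1 + g v 0) with hy' | hy'
    · rw [hy', if_neg (by omega)] at c1
      refine hfail s3 c1 c2 (c5.trans (b5.trans a4)) (c6.trans (b6.trans a5)) ?_
      refine decide_eq_false fun h => ?_
      have := h 0
      omega
    rw [hy', if_pos (by omega)] at c1
    have hpass : observedPass I g v = true := by
      refine decide_eq_true fun e => ?_
      fin_cases e
      exacts [hy', hy]
    simp only [hpass, if_true] at h4 ⊢
    refine (reaches_push c1 c2 c3 (by omega) (by omega)).trans ?_
    rintro s4 ⟨e1, e2, e3, e4⟩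
    have hmem : s3.mem = s.mem := c5.trans (b5.trans a4)
    have hstack : AtLoop I r f ((2 * v + 1) :: 2 * v :: stack) out s4 := by
      refine ⟨e1, e2, ⟨?_, ?_, ?_⟩, ?_⟩
      · rw [e3, List.length_cons, Function.update_self]
      · rw [e3, Function.update_of_ne (by omega), Function.update_self]
      · rw [e3, hmem]
        exact (hst.2.update le_rfl).update (by omega)
      · rw [e4, c6, b6, a5, hout]
    have hp2 : (2 : ℕ) ^ (n + 1) = 2 * 2 ^ n := by rw [pow_succ]; ring
    have hr1 : I.N ≤ (2 * v + 1) * 2 ^ n := by rw [hp2] at h1; nlinarith [Nat.zero_le (2 ^ n)]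
    have hr2 : (2 * v + 1 + 1) * 2 ^ n ≤ 2 ^ (d + 1) := by rw [hp2] at h2; nlinarith
    have hl1 : I.N ≤ 2 * v * 2 ^ n := by rw [hp2] at h1; nlinarith
    have hl2 : (2 * v + 1) * 2 ^ n ≤ 2 ^ (d + 1) := by nlinarith [Nat.zero_le (2 ^ n)]
    refine (ih (2 * v + 1) f (2 * v :: stack) out s4 hr1 hr2 (by omega) (by omega) (by omega)
      (by omega) (by simp only [List.length_cons]; omega) hstack).trans ?_
    rintro s5 ⟨f', k1, k2, k3⟩
    refine (ih (2 * v) f' stack _ s5 hl1 hl2 (by omega) (by omega) (by omega)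
      (by omega) (by omega) k3).trans ?_
    rintro s6 ⟨f'', l1, l2, l3⟩
    refine Reaches.refl ⟨f'', by omega, by omega, ?_⟩
    rwa [List.append_assoc] at l3

theorem reaches_halt_of_empty {w cF r f : ℕ} {I : DecoderInput} {out : List ℕ} {s : Config}
    (hs : AtLoop I r f [] out s) (hf : f < 2 ^ w) :
    Reaches w (decoder cF) I (fun s' => nextInstr (decoder cF) s' = .halt ∧ s'.out = out) s := by
  obtain ⟨pc, reg, mem, out'⟩ := s
  obtain ⟨h1, ⟨r0, r3, r4, r5, r7, r8, r9, r10, r11, r12, r13⟩, -, h4⟩ := hs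
  simp only [List.length_nil] at *
  subst h1 h4
  rcases Nat.eq_zero_or_pos f with rfl | hf0
  · refine Reaches.of_instr (.jumpLT 4 11 13) rfl ?_
    simp only [exec, r4, r11, lt_irrefl, if_false]
    exact Reaches.refl ⟨rfl, rfl⟩
  · refine Reaches.of_instr (.jumpLT 4 11 13) rfl ?_
    simp only [exec, r4, r11, hf0, if_true]
    refine Reaches.of_instr (.sub 11 11 3) rfl ?_
    simp only [exec, Config.write]
    refine Reaches.of_instr (.jumpLT 4 13 24) rfl ?_
    simp [exec, r4, r13]
    refine Reaches.of_instr (.jumpLT 4 12 17) rfl ?_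
    simp [exec, r4, r12]
    exact Reaches.refl ⟨rfl, rfl⟩

/-- The decoder halts, whatever the test results are. -/
theorem decoder_haltsWithin {w cF r : ℕ} {I : DecoderInput} (hr : (I.rowList 0).length = r)
    (hw : 1 + r * r + 3 * r < 2 ^ w) (hF : cF * (r * r) < 2 ^ w) (hc : cF < 2 ^ w)
    (hN : I.N < 2 ^ w) : HaltsWithin w (decoder cF) I (100 * (cF * (r * r)) + 2 + 11) := by
  obtain ⟨h1, h2, -, -⟩ := reaches_init hr hw hF hc hN
  have hinv : LoopInvariant (runSteps w (decoder cF) I 11) :=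
    ⟨h2.r3, h2.r4, by omega, by omega, by omega⟩
  have := exists_halt_le_ranking (w := w) (cF := cF) (I := I) (100 * (cF * (r * r)) + 2) _ hinv
    (by rw [h2.r11]; exact hF) (by simp [ranking, h1, h2.r11])
  rwa [runSteps_eq, ← Function.iterate_add_apply] at this

/-- If the fuel suffices for the exploration, the decoder returns all leaves that it reaches and
that pass the final check. -/
theorem decoder_out {w cF r L d t : ℕ} {I : DecoderInput} {g : ℕ → Fin 2 → ℕ}
    (hr : (I.rowList 0).length = r)
    (hw : 1 + r * r + 4 * r < 2 ^ w) (hF : cF * (r * r) < 2 ^ w) (hc : cF < 2 ^ w)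
    (htab : ∀ v < I.N, ColumnTable I r L g v) (hN : 1 < I.N)
    (hd : 2 ^ d ≤ 2 * I.N) (hd' : I.N ≤ 2 ^ d) (hw' : 4 * I.N + d + L < 2 ^ w)
    (hcost : exploreCost I.N L (observedPass I g) d 1 ≤ cF * (r * r))
    (ht : HaltsWithin w (decoder cF) I t) :
    (runSteps w (decoder cF) I t).out = exploreOutput I g d 1 := by
  obtain ⟨h1, h2, h3, h4⟩ := reaches_init hr (by omega) hF hc (by omega : I.N < 2 ^ w)
  have key := (reaches_exploreOutput (cF := cF) hw htab hd hw' d 1 (cF * (r * r)) [] []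
    (runSteps w (decoder cF) I 11) (by omega) (by rw [pow_succ]; omega) (by omega) (by omega)
    hcost hF (by simp) ⟨h1, h2, ⟨h3, trivial⟩, h4⟩).trans
      (Q' := fun s' => nextInstr (decoder cF) s' = .halt ∧ s'.out = exploreOutput I g d 1)
      fun s' ⟨f', _, k2, k3⟩ => reaches_halt_of_empty k3 (by omega)
  obtain ⟨m, hm, hm'⟩ := key
  rw [runSteps_eq, ← Function.iterate_add_apply, ← runSteps_eq] at hm hm'
  rw [ht.runSteps_eq hm, hm']

/-! ### The output of the exploration -/

theorem mem_exploreOutput {I : DecoderInput} {g : ℕ → Fin 2 → ℕ} {j : ℕ} :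
    ∀ n v, I.N ≤ v * 2 ^ n → v < 2 * I.N → j ∈ exploreOutput I g n v →
      j < I.N ∧ ∀ i ∈ I.colList j, I.outcomeAt i = 1 := by
  have hleaf : ∀ v, I.N ≤ v → v < 2 * I.N → j ∈ leafOutput I v →
      j < I.N ∧ ∀ i ∈ I.colList j, I.outcomeAt i = 1 := by
    intro v hv hv' h
    unfold leafOutput at h
    split_ifs at h with h'
    · rw [List.mem_singleton] at h
      subst h
      exact ⟨by omega, h'⟩
    · simp at h
  intro n
  induction n with
  | zero =>
    intro v h1 h3 h
    exact hleaf v (by omega) h3 h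
  | succ n ih =>
    intro v h1 h3 h
    rw [exploreOutput] at h
    split_ifs at h with hN hp
    · exact hleaf v hN h3 h
    · have hp2 : (2 : ℕ) ^ (n + 1) = 2 * 2 ^ n := by rw [pow_succ]; ring
      rw [hp2] at h1
      rcases List.mem_append.mp h with h | h
      · exact ih _ (by nlinarith [Nat.zero_le (2 ^ n)]) (by omega) h
      · exact ih _ (by nlinarith) (by omega) h
    · simp at h

theorem exploreOutput_mem {I : DecoderInput} {g : ℕ → Fin 2 → ℕ} {j : ℕ} (hj : j < I.N)
    (hcheck : ∀ i ∈ I.colList j, I.outcomeAt i = 1)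
    (hpass : ∀ u, 0 < u → u < I.N → Below u (I.N + j) → observedPass I g u = true) :
    ∀ n v, I.N ≤ v * 2 ^ n → 0 < v → Below v (I.N + j) → j ∈ exploreOutput I g n v := by
  have hleaf : ∀ v, I.N ≤ v → Below v (I.N + j) → j ∈ leafOutput I v := by
    rintro v hv ⟨k, hk⟩
    have hk0 : k = 0 := by
      by_contra h
      have h1 : (I.N + j) / 2 ^ k ≤ (I.N + j) / 2 ^ 1 :=
        Nat.div_le_div_left (Nat.pow_le_pow_right (by norm_num) (by omega)) (by norm_num)
      omega
    subst hk0
    rw [pow_zero, Nat.div_one] at hk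
    subst hk
    rw [leafOutput, Nat.add_sub_cancel_left, if_pos hcheck]
    exact List.mem_singleton_self j
  intro n
  induction n with
  | zero =>
    intro v h1 _ hb
    exact hleaf v (by omega) hb
  | succ n ih =>
    intro v h1 hv hb
    rw [exploreOutput]
    split_ifs with hN hp
    · exact hleaf v hN hb
    · have hp2 : (2 : ℕ) ^ (n + 1) = 2 * 2 ^ n := by rw [pow_succ]; ring
      rw [hp2] at h1
      obtain ⟨k, hk⟩ := hb
      rcases k with _ | k
      · simp at hk
        omega
      rw [pow_succ, ← Nat.div_div_eq_div_mul] at hk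
      rw [List.mem_append]
      have : (I.N + j) / 2 ^ k = 2 * v + 1 ∨ (I.N + j) / 2 ^ k = 2 * v := by omega
      rcases this with h | h
      · exact Or.inl (ih _ (by nlinarith [Nat.zero_le (2 ^ n)]) (by omega) ⟨k, h⟩)
      · exact Or.inr (ih _ (by nlinarith) (by omega) ⟨k, h⟩)
    · exact absurd (hpass v hv (by omega) hb) hp

/-! ### The test matrix -/

/-- The test matrix with labels `g` and `c`.  The items of row `0` are those below `r`; the rows
`1 + i` with `i < r * r` are the pool; the next `4 * r` rows form the lookup table, in which item
`v` stores the two tests of node `v`, each by two digits in base `r`; the other rows are empty. -/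
noncomputable def labelMatrix {N t : ℕ} (M d r : ℕ) (g : Fin N → Fin 2 → Fin (r * r))
    (c : Fin N → Fin t → Fin (r * r)) : TestMatrix M N :=
  open Classical in fun i j => decide (((i : ℕ) = 0 ∧ (j : ℕ) < r) ∨
    (∃ h : Fin (r * r), (i : ℕ) = 1 + h ∧ InPool d g c h j) ∨
    ((i : ℕ) = 1 + r * r + g j 0 / r ∨ (i : ℕ) = 1 + r * r + r + g j 0 % r) ∨
    ((i : ℕ) = 1 + r * r + 2 * r + g j 1 / r ∨ (i : ℕ) = 1 + r * r + 2 * r + r + g j 1 % r))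

theorem below_one {n : ℕ} (hn : 0 < n) : Below 1 n := by
  refine ⟨Nat.log 2 n, Nat.div_eq_of_lt_le ?_ ?_⟩
  · rw [one_mul]
    exact Nat.pow_log_le_self 2 hn.ne'
  · have := Nat.lt_pow_succ_log_self (b := 2) (by norm_num) n
    rw [pow_succ] at this
    linarith

theorem filter_range'_eq_singleton {p : ℕ → Bool} {a n x : ℕ} (h1 : a ≤ x) (h2 : x < a + n)
    (h : ∀ i, a ≤ i → i < a + n → (p i = true ↔ i = x)) :
    (List.range' a n).filter p = [x] := by
  have h3 : (List.range' a n).filter p = (List.range' a n).filter (fun i => i == x) := by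
    refine List.filter_congr fun i hi => ?_
    rw [List.mem_range'_1] at hi
    rw [Bool.eq_iff_iff, h i hi.1 hi.2, beq_iff_eq]
  rw [h3, List.filter_beq, List.count_eq_one_of_mem List.nodup_range'
    (List.mem_range'_1.mpr ⟨h1, h2⟩), List.replicate_one]

section Matrix

variable {N t M d r K : ℕ} {g : Fin N → Fin 2 → Fin (r * r)} {c : Fin N → Fin t → Fin (r * r)}
  {y : Fin M → Bool}

/-- The labels of the nodes as natural numbers. -/
def nodeTest (g : Fin N → Fin 2 → Fin (r * r)) (v : ℕ) (e : Fin 2) : ℕ :=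
  if h : v < N then g ⟨v, h⟩ e else 0

theorem nodeTest_eq (v : Fin N) (e : Fin 2) : nodeTest g v e = g v e := by
  simp [nodeTest]

theorem entryAt_labelMatrix {i : ℕ} (hi : i < M) (v : Fin N) :
    DecoderInput.entryAt ⟨N, K, M, labelMatrix M d r g c, y⟩ i v = true ↔
      ((i = 0 ∧ (v : ℕ) < r) ∨ (∃ h : Fin (r * r), i = 1 + h ∧ InPool d g c h v) ∨
        (i = 1 + r * r + g v 0 / r ∨ i = 1 + r * r + r + g v 0 % r) ∨
        (i = 1 + r * r + 2 * r + g v 1 / r ∨ i = 1 + r * r + 2 * r + r + g v 1 % r)) := by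
  simp [DecoderInput.entryAt, labelMatrix, hi]

theorem rowList_labelMatrix (hM : 0 < M) (hr : r ≤ N) :
    (DecoderInput.rowList ⟨N, K, M, labelMatrix M d r g c, y⟩ 0).length = r := by
  have h : DecoderInput.rowList ⟨N, K, M, labelMatrix M d r g c, y⟩ 0 = List.range r := by
    obtain ⟨m, rfl⟩ := Nat.exists_eq_add_of_le hr
    unfold DecoderInput.rowList
    rw [List.range_add, List.filter_append]
    have h1 : (List.range r).filter (fun j => DecoderInput.entryAt
        ⟨r + m, K, M, labelMatrix M d r g c, y⟩ 0 j) = List.range r := by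
      refine List.filter_eq_self.mpr fun j hj => ?_
      rw [List.mem_range] at hj
      exact (entryAt_labelMatrix hM ⟨j, by omega⟩).mpr (Or.inl ⟨rfl, hj⟩)
    rw [h1, List.append_right_eq_self, List.filter_eq_nil_iff]
    intro j hj
    obtain ⟨j, hj', rfl⟩ := List.mem_map.mp hj
    rw [List.mem_range] at hj'
    refine fun h => ?_
    have := (entryAt_labelMatrix hM ⟨r + j, by omega⟩).mp h
    simp only at this
    have hn0 := Nat.zero_le ((g ⟨r + j, by omega⟩ 0 : ℕ) / r)
    have hn1 := Nat.zero_le ((g ⟨r + j, by omega⟩ 1 : ℕ) / r)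
    rcases this with ⟨-, h⟩ | ⟨h, hh, -⟩ | h | h <;> omega
  rw [h, List.length_range]

/-- The part of a column in row `0` and in the pool. -/
theorem length_filter_pool_le (hM : 1 + r * r ≤ M) (v : Fin N) (hr : 0 < r) :
    ((List.range' 0 (1 + r * r)).filter fun i => DecoderInput.entryAt
      ⟨N, K, M, labelMatrix M d r g c, y⟩ i v).length ≤ 1 + (t + 2 * d) := by
  classical
  rw [← List.toFinset_card_of_nodup ((List.nodup_range' (step := 1)).filter _)]
  have hsub : ((List.range' 0 (1 + r * r)).filter fun i => DecoderInput.entryAt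
      ⟨N, K, M, labelMatrix M d r g c, y⟩ i v).toFinset ⊆
      {0} ∪ (positives d {v} ∅ g c).image fun h : Fin (r * r) => 1 + (h : ℕ) := by
    have hn0 := Nat.zero_le ((g v 0 : ℕ) / r)
    have hn1 := Nat.zero_le ((g v 1 : ℕ) / r)
    intro i hi
    rw [List.mem_toFinset, List.mem_filter, List.mem_range'_1, entryAt_labelMatrix (by omega)] at hi
    rw [Finset.mem_union, Finset.mem_singleton, Finset.mem_image]
    rcases hi.2 with h | ⟨h, hh, hp⟩ | h | h
    · exact Or.inl h.1
    · refine Or.inr ⟨h, mem_positives.mpr (Or.inr ⟨v, Finset.mem_singleton_self v, hp⟩), hh.symm⟩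
    · omega
    · omega
  refine (Finset.card_le_card hsub).trans ((Finset.card_union_le _ _).trans ?_)
  refine Nat.add_le_add (by simp) (Finset.card_image_le.trans ?_)
  simpa using card_positives_le d {v} ∅ g c

theorem colList_labelMatrix (hM : 1 + r * r + 4 * r ≤ M) (v : Fin N) :
    DecoderInput.colList ⟨N, K, M, labelMatrix M d r g c, y⟩ v =
      ((List.range' 0 (1 + r * r)).filter fun i => DecoderInput.entryAt
        ⟨N, K, M, labelMatrix M d r g c, y⟩ i v) ++
      [1 + r * r + g v 0 / r, 1 + r * r + r + g v 0 % r,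
        1 + r * r + 2 * r + g v 1 / r, 1 + r * r + 2 * r + r + g v 1 % r] := by
  have hr : 0 < r := by
    have := (g v 0).2
    exact Nat.pos_of_ne_zero fun h => by simp [h] at this
  have hd0 : (g v 0 : ℕ) / r < r := Nat.div_lt_of_lt_mul (g v 0).2
  have hd1 : (g v 1 : ℕ) / r < r := Nat.div_lt_of_lt_mul (g v 1).2
  have hn0 := Nat.zero_le ((g v 0 : ℕ) / r)
  have hn1 := Nat.zero_le ((g v 1 : ℕ) / r)
  have hm0 : (g v 0 : ℕ) % r < r := Nat.mod_lt _ hr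
  have hm1 : (g v 1 : ℕ) % r < r := Nat.mod_lt _ hr
  obtain ⟨m, rfl⟩ := Nat.exists_eq_add_of_le hM
  have hsplit : List.range (1 + r * r + 4 * r + m) = List.range' 0 (1 + r * r) ++
      (List.range' (1 + r * r) r ++ (List.range' (1 + r * r + r) r ++
      (List.range' (1 + r * r + r + r) r ++ (List.range' (1 + r * r + r + r + r) r ++
      List.range' (1 + r * r + r + r + r + r) m)))) := by
    have h0 := List.range'_append_1 (s := 0) (m := 1 + r * r) (n := r + (r + (r + (r + m))))
    rw [zero_add] at h0
    rw [List.range'_append_1, List.range'_append_1, List.range'_append_1, List.range'_append_1, h0,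
      List.range_eq_range']
    congr 1
    ring
  have hpool : ∀ {i : ℕ}, 1 + r * r ≤ i →
      ¬ ((i = 0 ∧ (v : ℕ) < r) ∨ ∃ h : Fin (r * r), i = 1 + h ∧ InPool d g c h v) := by
    rintro i hi (h | ⟨h, hh, -⟩)
    · omega
    · omega
  unfold DecoderInput.colList
  simp only
  rw [hsplit]
  simp only [List.filter_append]
  congr 1
  rw [filter_range'_eq_singleton (x := 1 + r * r + g v 0 / r) (by omega) (by omega),
    filter_range'_eq_singleton (x := 1 + r * r + r + g v 0 % r) (by omega) (by omega),
    filter_range'_eq_singleton (x := 1 + r * r + 2 * r + g v 1 / r) (by omega) (by omega),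
    filter_range'_eq_singleton (x := 1 + r * r + 2 * r + r + g v 1 % r) (by omega) (by omega),
    List.filter_eq_nil_iff.mpr]
  · rfl
  · intro i hi
    rw [List.mem_range'_1] at hi
    rw [entryAt_labelMatrix (by omega), ← or_assoc, or_iff_right (hpool (by omega))]
    omega
  all_goals
    intro i hi hi'
    rw [entryAt_labelMatrix (by omega), ← or_assoc, or_iff_right (hpool (by omega))]
    omega

theorem columnTable_labelMatrix (hM : 1 + r * r + 4 * r ≤ M) :
    ∀ v < N, ColumnTable ⟨N, K, M, labelMatrix M d r g c, y⟩ r (t + 2 * d + 7) (nodeTest g) v := by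
  intro v hv
  obtain ⟨v, rfl⟩ : ∃ v' : Fin N, (v' : ℕ) = v := ⟨⟨v, hv⟩, rfl⟩
  have hr : 0 < r := by
    have := (g v 0).2
    exact Nat.pos_of_ne_zero fun h => by simp [h] at this
  have hd0 : (g v 0 : ℕ) / r < r := Nat.div_lt_of_lt_mul (g v 0).2
  have hd1 : (g v 1 : ℕ) / r < r := Nat.div_lt_of_lt_mul (g v 1).2
  have hn0 := Nat.zero_le ((g v 0 : ℕ) / r)
  have hn1 := Nat.zero_le ((g v 1 : ℕ) / r)
  have hm0 : (g v 0 : ℕ) % r < r := Nat.mod_lt _ hr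
  have hm1 : (g v 1 : ℕ) % r < r := Nat.mod_lt _ hr
  refine ⟨fun e => ?_, fun i hi => ?_, ((List.range' 0 (1 + r * r)).filter fun i =>
    DecoderInput.entryAt ⟨N, K, M, labelMatrix M d r g c, y⟩ i v).length, ?_, ?_, ?_, ?_⟩
  · rw [nodeTest_eq]
    exact (g v e).2
  · rw [colList_labelMatrix hM, List.mem_append] at hi
    rcases hi with hi | hi
    · have := List.mem_range'_1.mp (List.mem_filter.mp hi).1
      omega
    · simp at hi
      omega
  · rw [colList_labelMatrix hM, List.length_append]
    rfl
  · have := length_filter_pool_le (K := K) (g := g) (c := c) (y := y) (d := d) (by omega) v hr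
    omega
  · rw [Stores, colList_labelMatrix hM, nodeTest_eq]
    constructor <;> simp
  · rw [Stores, colList_labelMatrix hM, nodeTest_eq]
    constructor <;> simp [add_assoc]

/-! ### Success of the decoder -/

/-- The tests of the pool hit by the noise `z`. -/
def poolNoise (r : ℕ) (z : Fin M → Bool) (hM : 1 + r * r + 4 * r ≤ M) : Finset (Fin (r * r)) :=
  Finset.univ.filter fun h => z ⟨1 + h, by omega⟩ = true

theorem trueResult_pool (hM : 1 + r * r + 4 * r ≤ M) (S : Finset (Fin N)) (h : Fin (r * r)) :
    trueResult (labelMatrix M d r g c) S ⟨1 + h, by omega⟩ = true ↔ ∃ j ∈ S, InPool d g c h j := by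
  have key : ∀ j : Fin N, labelMatrix M d r g c ⟨1 + h, by omega⟩ j = true ↔ InPool d g c h j := by
    intro j
    have h1 := entryAt_labelMatrix (K := 0) (y := fun _ => false) (g := g) (c := c) (d := d)
      (show 1 + (h : ℕ) < M by omega) j
    have hn0 := Nat.zero_le ((g j 0 : ℕ) / r)
    have hn1 := Nat.zero_le ((g j 1 : ℕ) / r)
    have hh := h.2
    rw [DecoderInput.entryAt, dif_pos ⟨show 1 + (h : ℕ) < M by omega, j.2⟩] at h1
    refine h1.trans ⟨?_, ?_⟩
    · rintro (h2 | ⟨h', h2, hp⟩ | h2 | h2)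
      · omega
      · rwa [show h = h' from Fin.ext (by omega)]
      · omega
      · omega
    · exact fun hp => Or.inr (Or.inl ⟨h, rfl, hp⟩)
  rw [trueResult, decide_eq_true_eq]
  constructor
  · rintro ⟨j, h1, h2⟩
    exact ⟨j, h2, (key j).mp h1⟩
  · rintro ⟨j, h1, h2⟩
    exact ⟨j, (key j).mpr h2, h1⟩

theorem outcomeAt_pool (hM : 1 + r * r + 4 * r ≤ M) (S : Finset (Fin N)) (z : Fin M → Bool)
    (h : Fin (r * r)) :
    DecoderInput.outcomeAt ⟨N, K, M, labelMatrix M d r g c, fun i =>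
      trueResult (labelMatrix M d r g c) S i || z i⟩ (1 + h) = 1 ↔
      h ∈ positives d S (poolNoise r z hM) g c := by
  have hh : 1 + (h : ℕ) < M := by have := h.2; omega
  rw [DecoderInput.outcomeAt, dif_pos hh, mem_positives, ← trueResult_pool hM S h, poolNoise,
    Finset.mem_filter, Bool.toNat_eq_one, Bool.or_eq_true]
  simp only [Finset.mem_univ, true_and]
  exact or_comm

theorem observedPass_eq_nodePass (hM : 1 + r * r + 4 * r ≤ M) (S : Finset (Fin N))
    (z : Fin M → Bool) {v : ℕ} (hv : v < N) :
    observedPass ⟨N, K, M, labelMatrix M d r g c, fun i =>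
      trueResult (labelMatrix M d r g c) S i || z i⟩ (nodeTest g) v =
      nodePass (positives d S (poolNoise r z hM) g c) g v := by
  obtain ⟨v, rfl⟩ : ∃ v' : Fin N, (v' : ℕ) = v := ⟨⟨v, hv⟩, rfl⟩
  rw [observedPass, nodePass, dif_pos hv, decide_eq_decide]
  refine forall_congr' fun e => ?_
  rw [nodeTest_eq, outcomeAt_pool hM]

/-- The decoder returns the defective set, unless the labels are bad for the noise. -/
theorem outputsWithin_of_not_badLabels {w cF T : ℕ} (hM : 1 + r * r + 4 * r ≤ M) (hr : r ≤ N)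
    (hw : 1 + r * r + 4 * r < 2 ^ w) (hF : cF * (r * r) < 2 ^ w) (hc : cF < 2 ^ w)
    (hN : 1 < N) (hd : 2 ^ d ≤ 2 * N) (hd' : N ≤ 2 ^ d)
    (hw' : 4 * N + d + (t + 2 * d + 7) < 2 ^ w) (hT : 100 * (cF * (r * r)) + 13 ≤ T)
    (S : Finset (Fin N)) (z : Fin M → Bool)
    (hgood : ¬ BadLabels d (t + 2 * d + 7) (cF * (r * r)) S (poolNoise r z hM) (g, c)) :
    OutputsWithin w (decoder cF) ⟨N, K, M, labelMatrix M d r g c, fun i =>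
      trueResult (labelMatrix M d r g c) S i || z i⟩ T S := by
  set I : DecoderInput := ⟨N, K, M, labelMatrix M d r g c, fun i =>
      trueResult (labelMatrix M d r g c) S i || z i⟩ with hI
  have hrow : (I.rowList 0).length = r := rowList_labelMatrix (by omega) hr
  have hhalt : HaltsWithin w (decoder cF) I T :=
    (decoder_haltsWithin hrow (by omega) hF hc (by change N < _; omega)).mono (by omega)
  refine ⟨hhalt, ?_⟩
  simp only [BadLabels, not_or, not_lt, not_exists, not_and] at hgood
  obtain ⟨hcost, hpriv⟩ := hgood
  have hcost' : exploreCost I.N (t + 2 * d + 7) (observedPass I (nodeTest g)) d 1 ≤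
      cF * (r * r) := by
    rw [exploreCost_congr d 1 one_pos fun u hu _ => observedPass_eq_nodePass hM S z hu]
    exact hcost
  rw [decoder_out (I := I) hrow hw hF hc (columnTable_labelMatrix hM) hN hd hd' hw' hcost' hhalt]
  have houtM : ∀ i, I.outcomeAt i = 1 ↔
      ∃ h : i < M, trueResult (labelMatrix M d r g c) S ⟨i, h⟩ = true ∨ z ⟨i, h⟩ = true := by
    intro i
    rw [DecoderInput.outcomeAt]
    split_ifs with h
    · rw [Bool.toNat_eq_one, Bool.or_eq_true]
      exact ⟨fun h' => ⟨h, h'⟩, fun ⟨_, h'⟩ => h'⟩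
    · refine iff_of_false (by norm_num) ?_
      exact fun ⟨h', _⟩ => h h'
  ext j
  rw [List.mem_toFinset, Finset.mem_map]
  constructor
  · intro hj
    obtain ⟨hjN, hcheck⟩ := mem_exploreOutput d 1 (by change N ≤ _; omega)
      (by change 1 < 2 * N; omega) hj
    refine ⟨⟨j, hjN⟩, ?_, rfl⟩
    -- an item outside `S` has a negative private test
    by_contra hjS
    refine hpriv _ hjS fun k => ?_
    rw [← outcomeAt_pool (K := K) hM]
    refine hcheck _ ?_
    have hlt := (c ⟨j, hjN⟩ k).2
    refine List.mem_filter.mpr ⟨List.mem_range.mpr (by change _ < M; omega), ?_⟩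
    exact (entryAt_labelMatrix (by omega) ⟨j, hjN⟩).mpr
      (Or.inr (Or.inl ⟨_, rfl, Or.inl ⟨k, rfl⟩⟩))
  · rintro ⟨j, hjS, rfl⟩
    have hjN : (j : ℕ) < N := j.2
    refine exploreOutput_mem (I := I) j.2 ?_ ?_ d 1 (by change N ≤ _; omega) one_pos ?_
    · -- all tests of a defective item are positive
      intro i hi
      obtain ⟨h1, h2⟩ := List.mem_filter.mp hi
      rw [List.mem_range] at h1
      rw [houtM]
      refine ⟨h1, Or.inl ?_⟩
      rw [trueResult, decide_eq_true_eq]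
      refine ⟨j, ?_, hjS⟩
      have h3 : (i < I.M ∧ ((Fin.valEmbedding j : ℕ)) < I.N) := ⟨h1, j.2⟩
      exact (dif_pos h3).symm.trans h2
    · rintro u hu0 huN ⟨k, hk⟩
      change (N + (j : ℕ)) / 2 ^ k = u at hk
      change u < N at huN
      rw [observedPass_eq_nodePass hM S z huN, nodePass, dif_pos huN, decide_eq_true_eq]
      intro e
      rw [mem_positives]
      refine Or.inr ⟨j, hjS, Or.inr ⟨⟨u, huN⟩, e, ?_, rfl⟩⟩
      -- the depth of `u` is positive since `u` is not a leaf, and at most `d`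
      rcases k with _ | k
      · simp at hk
        omega
      refine ⟨k, ?_, hk⟩
      by_contra hkd
      have h4 : 2 ^ (d + 1) ≤ 2 ^ (k + 1) := Nat.pow_le_pow_right (by norm_num) (by omega)
      have h5 : (N + (j : ℕ)) / 2 ^ (k + 1) = 0 := by
        refine Nat.div_eq_of_lt (lt_of_lt_of_le ?_ h4)
        rw [pow_succ]
        omega
      omega
    · exact below_one (by change 0 < N + (j : ℕ); omega)

end Matrix

/-! ### The failure probability -/

/-- The law of the test matrix with independent uniform labels. -/
noncomputable def matrixLaw (M N d r t : ℕ) [Nonempty (Fin (r * r))] : PMF (TestMatrix M N) :=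
  (PMF.uniformOfFintype ((Fin N → Fin 2 → Fin (r * r)) × (Fin N → Fin t → Fin (r * r)))).map
    fun ω => labelMatrix M d r ω.1 ω.2

theorem exists_of_mem_support_matrixLaw {M N d r t : ℕ} [Nonempty (Fin (r * r))]
    {A : TestMatrix M N} (hA : A ∈ (matrixLaw M N d r t).support) :
    ∃ (g : Fin N → Fin 2 → Fin (r * r)) (c : Fin N → Fin t → Fin (r * r)),
      labelMatrix M d r g c = A := by
  rw [matrixLaw, PMF.mem_support_map_iff] at hA
  obtain ⟨ω, -, h⟩ := hA
  exact ⟨ω.1, ω.2, h⟩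

theorem failureProb_matrixLaw_le {M N K d r t w cF T : ℕ} [Nonempty (Fin (r * r))] {ρ : ℝ}
    (h0 : 0 ≤ ρ) (h1 : ρ ≤ 481 / 1000) (hM : 1 + r * r + 4 * r ≤ M) (hr : r ≤ N)
    (hw : 1 + r * r + 4 * r < 2 ^ w) (hF : cF * (r * r) < 2 ^ w) (hc : cF < 2 ^ w)
    (hN : 1 < N) (hd : 2 ^ d ≤ 2 * N) (hd' : N ≤ 2 ^ d)
    (hw' : 4 * N + d + (t + 2 * d + 7) < 2 ^ w) (hT : 100 * (cF * (r * r)) + 13 ≤ T)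
    (S : Finset (Fin N)) (hload : (S.card : ℝ) * (t + 2 * d) ≤ 3 / 20 * (r * r : ℕ)) :
    failureProb ρ w (decoder cF) T K (matrixLaw M N d r t) S ≤
      Real.exp (-((r * r : ℕ) / 2500)) +
        (Real.exp (S.card + 1 - (cF * (r * r) : ℕ) / (64 * (t + 2 * d + 7 : ℕ))) +
          N * (13 / 20) ^ t) := by
  classical
  set Ω := (Fin N → Fin 2 → Fin (r * r)) × (Fin N → Fin t → Fin (r * r))
  set δ : ℝ := Real.exp (S.card + 1 - (cF * (r * r) : ℕ) / (64 * (t + 2 * d + 7 : ℕ))) +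
          N * (13 / 20) ^ t with hδ
  have hδ0 : 0 ≤ δ := by positivity
  have hrr : 0 < r * r := Fin.pos_iff_nonempty.mpr inferInstance
  -- the rows of the pool
  set P : Finset (Fin M) := Finset.univ.map
    ⟨fun h : Fin (r * r) => (⟨1 + h, by omega⟩ : Fin M), fun a b hab => by
      simpa [Fin.ext_iff] using hab⟩ with hP
  have hPc : P.card = r * r := by simp [hP]
  have hPz : ∀ z : Fin M → Bool, (P.filter fun i => z i = true).card = (poolNoise r z hM).card := by
    intro z
    rw [hP, Finset.filter_map, Finset.card_map]
    rfl
  set bad : (Fin M → Bool) → ℝ := fun z =>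
    if P.card < 2 * (P.filter fun i => z i = true).card then 1 else 0 with hbad
  have hnoise := sum_noise_le h0 h1 P
  have hcard : (0 : ℝ) < Fintype.card Ω := by exact_mod_cast Fintype.card_pos
  have hpt : ∀ (ω : Ω) (z : Fin M → Bool),
      (if OutputsWithin w (decoder cF) ⟨N, K, M, labelMatrix M d r ω.1 ω.2, fun i =>
        trueResult (labelMatrix M d r ω.1 ω.2) S i || z i⟩ T S then (0 : ℝ) else 1) ≤
      bad z + (1 - bad z) *
        (if BadLabels d (t + 2 * d + 7) (cF * (r * r)) S (poolNoise r z hM) ω then 1 else 0) := by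
    intro ω z
    by_cases hb : BadLabels d (t + 2 * d + 7) (cF * (r * r)) S (poolNoise r z hM) ω
    · rw [if_pos hb]
      split_ifs <;> linarith
    · rw [if_pos (outputsWithin_of_not_badLabels hM hr hw hF hc hN hd hd' hw' hT S z hb),
        if_neg hb]
      simp only [hbad]
      split_ifs <;> norm_num
  have hlabels : ∀ z : Fin M → Bool, (1 - bad z) * ∑ ω : Ω,
      (if BadLabels d (t + 2 * d + 7) (cF * (r * r)) S (poolNoise r z hM) ω then (1 : ℝ) else 0) ≤
      δ * Fintype.card Ω := by
    intro z
    by_cases hz : P.card < 2 * (P.filter fun i => z i = true).card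
    · simp only [hbad, if_pos hz, sub_self, zero_mul]
      positivity
    · simp only [hbad, if_neg hz, sub_zero, one_mul]
      have hz' : ((poolNoise r z hM).card : ℝ) ≤ (r * r : ℕ) / 2 := by
        rw [hPc, hPz, not_lt] at hz
        have : (2 : ℝ) * (poolNoise r z hM).card ≤ (r * r : ℕ) := by exact_mod_cast hz
        linarith
      refine le_trans (le_of_eq ?_) (sum_badLabels_le (F := cF * (r * r)) hrr hd
        (by omega : d ≤ t + 2 * d + 7) (by omega) hz' hload)
      exact Finset.sum_congr rfl fun ω _ => by congr
  have hexp : failureProb ρ w (decoder cF) T K (matrixLaw M N d r t) S =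
      (∑ ω : Ω, ∑ z : Fin M → Bool, fpcProb ρ (fun _ => false) z *
        (if OutputsWithin w (decoder cF) ⟨N, K, M, labelMatrix M d r ω.1 ω.2, fun i =>
        trueResult (labelMatrix M d r ω.1 ω.2) S i || z i⟩ T S then (0 : ℝ) else 1)) /
        Fintype.card Ω := by
    unfold failureProb matrixLaw
    refine (sum_map_uniform_mul _ _).trans ?_
    congr 1
    refine Finset.sum_congr rfl fun ω _ => ?_
    refine (sum_fpcProb_mul ρ _ _).trans ?_
    refine Finset.sum_congr rfl fun z _ => ?_
    congr
  rw [hexp, div_le_iff₀ hcard]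
  calc _ ≤ ∑ ω : Ω, ∑ z : Fin M → Bool, fpcProb ρ (fun _ => false) z * (bad z + (1 - bad z) *
        (if BadLabels d (t + 2 * d + 7) (cF * (r * r)) S (poolNoise r z hM) ω then 1 else 0)) :=
        Finset.sum_le_sum fun ω _ => Finset.sum_le_sum fun z _ =>
          mul_le_mul_of_nonneg_left (hpt ω z) (fpcProb_nonneg h0 (by linarith) _ _)
    _ = ∑ z : Fin M → Bool, fpcProb ρ (fun _ => false) z * (bad z * Fintype.card Ω +
        (1 - bad z) * ∑ ω : Ω, (if BadLabels d (t + 2 * d + 7) (cF * (r * r)) S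
          (poolNoise r z hM) ω then (1 : ℝ) else 0)) := by
        rw [Finset.sum_comm]
        refine Finset.sum_congr rfl fun z _ => ?_
        rw [← Finset.mul_sum, Finset.sum_add_distrib, ← Finset.mul_sum, Finset.sum_const,
          Finset.card_univ, nsmul_eq_mul, mul_comm (bad z)]
    _ ≤ ∑ z : Fin M → Bool, fpcProb ρ (fun _ => false) z * (bad z * Fintype.card Ω +
        δ * Fintype.card Ω) :=
        Finset.sum_le_sum fun z _ => mul_le_mul_of_nonneg_left (by linarith [hlabels z])
          (fpcProb_nonneg h0 (by linarith) _ _)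
    _ = (∑ z, fpcProb ρ (fun _ => false) z * bad z + δ * ∑ z : Fin M → Bool,
        fpcProb ρ (fun _ => false) z) * Fintype.card Ω := by
        rw [Finset.mul_sum, ← Finset.sum_add_distrib, Finset.sum_mul]
        exact Finset.sum_congr rfl fun z _ => by ring
    _ ≤ _ := by
        rw [sum_fpcProb_eq_one, mul_one]
        refine mul_le_mul_of_nonneg_right ?_ hcard.le
        rw [← hPc]
        linarith

/-! ### Choice of the parameters -/

theorem thirteen_twentieths_le : (13 / 20 : ℝ) ≤ Real.exp (-(2 / 5)) := by
  refine (pow_le_pow_iff_left₀ (by norm_num) (Real.exp_pos _).le (n := 5) (by norm_num)).mp ?_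
  rw [← Real.exp_nat_mul, show ((5 : ℕ) : ℝ) * -(2 / 5) = -(1 + 1) by norm_num, Real.exp_neg,
    Real.exp_add, le_inv_comm₀ (by norm_num) (by positivity)]
  have h := Real.exp_one_lt_d9
  nlinarith [Real.exp_pos 1]

/-- The condition on the parameters forces the noise density below `(log 2) ^ 2`, and at least
twice as many tests as the noiseless scheme. -/
theorem density_and_rate {ρ ζ ε : ℝ} (h0 : 0 ≤ ρ) (h1 : ρ ≤ 1) (hζ : 0 < ζ) (hε : 0 < ε)
    (hε' : ε < 1 / 4) (h : ζ * ρ - ρ + 1 ≤ ζ * (Real.log (2 - 4 * ε)) ^ 2) :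
    ρ ≤ 481 / 1000 ∧ 2 ≤ ζ := by
  have hl0 : 0 ≤ Real.log (2 - 4 * ε) := Real.log_nonneg (by linarith)
  have hl1 : Real.log (2 - 4 * ε) ≤ 6932 / 10000 :=
    (Real.log_le_log (by linarith) (by linarith)).trans (Real.log_two_lt_d9.le.trans (by norm_num))
  have hl2 : (Real.log (2 - 4 * ε)) ^ 2 ≤ 4806 / 10000 := by nlinarith
  have h2 : ζ * (Real.log (2 - 4 * ε)) ^ 2 ≤ ζ * (4806 / 10000) :=
    mul_le_mul_of_nonneg_left hl2 hζ.le
  have h3 : ρ ≤ 481 / 1000 := by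
    by_contra hρ
    push Not at hρ
    nlinarith
  refine ⟨h3, ?_⟩
  by_contra hζ2
  push Not at hζ2
  nlinarith

theorem card_lt_two_pow_mul_size {a N : ℕ} (hN : 0 < N) :
    (a + 1) * (N + 1) ^ 3 ≤ 2 ^ ((a + 3) * Nat.size N) := by
  have h1 : N + 1 ≤ 2 ^ Nat.size N := Nat.lt_size_self N
  have h2 : 1 ≤ Nat.size N := Nat.size_pos.mpr hN
  rw [add_mul a 3, pow_add]
  refine Nat.mul_le_mul ?_ ?_
  · exact (Nat.lt_two_pow_self (n := a)).trans_le
      (Nat.pow_le_pow_right (by norm_num) (Nat.le_mul_of_pos_right a h2))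
  · rw [mul_comm, pow_mul]
    exact Nat.pow_le_pow_left h1 3

theorem natLog_two_le {N : ℕ} (hN : N ≠ 0) : (Nat.log 2 N : ℝ) ≤ 29 / 20 * Real.log N := by
  have h2 : ((2 : ℕ) ^ Nat.log 2 N : ℝ) ≤ N := by exact_mod_cast Nat.pow_log_le_self 2 hN
  have h3 : (Nat.log 2 N : ℝ) * Real.log 2 ≤ Real.log N := by
    rw [← Real.log_pow]
    exact Real.log_le_log (by positivity) (by exact_mod_cast h2)
  have h4 := Real.log_two_gt_d9
  have h5 := mul_le_mul_of_nonneg_left h4.le (Nat.cast_nonneg (α := ℝ) (Nat.log 2 N))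
  linarith

/-- The least `r` with `T₀ ≤ r ^ 2` leaves room for the lookup table in `2 * T₀` tests. -/
theorem ceil_sqrt_bounds {T₀ : ℝ} (h : 49 ≤ T₀) :
    7 ≤ ⌈Real.sqrt T₀⌉₊ ∧ T₀ ≤ (⌈Real.sqrt T₀⌉₊ : ℝ) * ⌈Real.sqrt T₀⌉₊ ∧
      1 + (⌈Real.sqrt T₀⌉₊ : ℝ) * ⌈Real.sqrt T₀⌉₊ + 4 * ⌈Real.sqrt T₀⌉₊ ≤ 2 * T₀ := by
  have hs7 : 7 ≤ Real.sqrt T₀ := Real.le_sqrt_of_sq_le (by linarith)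
  have hss : Real.sqrt T₀ * Real.sqrt T₀ = T₀ := Real.mul_self_sqrt (by linarith)
  have hr1 : Real.sqrt T₀ ≤ ⌈Real.sqrt T₀⌉₊ := Nat.le_ceil _
  have hr2 : (⌈Real.sqrt T₀⌉₊ : ℝ) ≤ Real.sqrt T₀ + 1 := (Nat.ceil_lt_add_one (by linarith)).le
  refine ⟨?_, ?_, ?_⟩
  · have : (7 : ℝ) ≤ ⌈Real.sqrt T₀⌉₊ := hs7.trans hr1
    exact_mod_cast this
  · have := mul_self_le_mul_self (by linarith) hr1
    linarith
  · have h1 := mul_self_le_mul_self (by linarith) hr2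
    have h2 := mul_le_mul_of_nonneg_right hs7 (by linarith : 0 ≤ Real.sqrt T₀)
    linarith

theorem le_numTests {C a ζ : ℝ} {b K N n : ℕ} (ha : 1 ≤ a) (hC : 2 * a ≤ C) (hζ : 2 ≤ ζ)
    (hb : 0 < b) (hx : 0 ≤ Real.log N) (hn : (n : ℝ) ≤ 2 * (40 * (a * K * Real.log N))) :
    n ≤ numTests C ζ b K N := by
  refine Nat.le_floor (hn.trans ?_)
  have he : 20 ≤ Real.exp (b + 2) := by
    have hb1 : (1 : ℝ) ≤ b := by exact_mod_cast hb
    have h2 : Real.exp (1 + 1 + 1) ≤ Real.exp (b + 2) := Real.exp_le_exp.mpr (by linarith)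
    rw [Real.exp_add, Real.exp_add] at h2
    have h3 := Real.exp_one_gt_d9
    have h4 : (7.38 : ℝ) ≤ Real.exp 1 * Real.exp 1 := by nlinarith
    nlinarith
  have h2 : 2 * a * 20 ≤ C * Real.exp (b + 2) := mul_le_mul hC he (by norm_num) (by linarith)
  have h3 : 2 * a * 20 * 2 ≤ C * Real.exp (b + 2) * ζ :=
    mul_le_mul h2 hζ (by norm_num) (by linarith)
  have h5 := mul_le_mul_of_nonneg_right h3 (mul_nonneg (Nat.cast_nonneg (α := ℝ) K) hx)
  linarith

theorem le_stepBound {D ε : ℝ} {K N n : ℕ} (hD : 0 ≤ D) (hε : 0 < ε) (hε' : ε < 1 / 4)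
    (hn : (n : ℝ) ≤ D * (K * Real.log N)) : n ≤ stepBound D ε K N := by
  refine Nat.le_floor (hn.trans ?_)
  have he : 1 ≤ (ε ^ 2)⁻¹ := by
    rw [one_le_inv₀ (by positivity)]
    nlinarith
  rw [mul_assoc _ (K : ℝ)]
  exact mul_le_mul_of_nonneg_right (le_mul_of_one_le_right hD he) (by positivity)

set_option maxHeartbeats 800000 in
/-- The scheme for one number of items `N` that is large enough in terms of `η` and `b`. -/
theorem exists_scheme {C η ρ ζ ε : ℝ} {b K N : ℕ} (hη : 0 < η) (hC : 2 * (1 + η) ≤ C)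
    (h0 : 0 ≤ ρ) (h1 : ρ ≤ 481 / 1000) (hζ : 2 ≤ ζ) (hε : 0 < ε) (hε' : ε < 1 / 4) (hb : 0 < b)
    (hK : 1 ≤ K) (hKN : K ≤ N) (hx : 100 ≤ Real.log N) (hbx : b ≤ Real.log N * (2 / 125))
    (hxN : 80 * (1 + η) * Real.log N ≤ N) :
    ∃ μ : PMF (TestMatrix (numTests C ζ b K N) N),
      (∀ A ∈ μ.support, ∀ y, HaltsWithin ((10 * (b + 2) + 3) * Nat.size N) (decoder (10 * (b + 2)))
        ⟨N, K, _, A, y⟩ (stepBound (8000 * (10 * (b + 2)) * (1 + η) + 13) ε K N)) ∧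
      ∀ S : Finset (Fin N), S.card ≤ K →
        failureProb ρ ((10 * (b + 2) + 3) * Nat.size N) (decoder (10 * (b + 2)))
          (stepBound (8000 * (10 * (b + 2)) * (1 + η) + 13) ε K N) K μ S ≤
            2 * ((K : ℝ) ^ (-(b : ℝ)) + (N : ℝ) ^ (-η)) := by
  set x := Real.log N with hxdef
  set a := 1 + η with ha
  have ha1 : 1 ≤ a := by linarith
  have hax : x ≤ a * x := le_mul_of_one_le_left (by linarith) ha1
  have hK1 : (1 : ℝ) ≤ K := by exact_mod_cast hK
  have hKN' : (K : ℝ) ≤ N := by exact_mod_cast hKN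
  have hN100 : (8000 : ℝ) ≤ N := by linarith
  have hN100' : 8000 ≤ N := by exact_mod_cast hN100
  -- the least size of the pool
  set T₀ := 40 * (a * K * x) with hT₀
  have hx0 : 0 ≤ x := by linarith
  have hax0 : 0 ≤ a * x := by linarith
  have hKx : x ≤ K * x := le_mul_of_one_le_left hx0 hK1
  have haKx : a * x ≤ a * K * x := by
    rw [mul_assoc]
    exact mul_le_mul_of_nonneg_left hKx (by linarith)
  have hT₀49 : 49 ≤ T₀ := by linarith
  set r := ⌈Real.sqrt T₀⌉₊ with hr
  obtain ⟨hr7, hrT, hrT2⟩ : 7 ≤ r ∧ T₀ ≤ (r : ℝ) * r ∧ 1 + (r : ℝ) * r + 4 * r ≤ 2 * T₀ :=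
    ceil_sqrt_bounds hT₀49
  have hr0 : (0 : ℝ) ≤ r := Nat.cast_nonneg r
  have hrN : r ≤ N := by
    have h2 : a * K * x ≤ N * (a * x) := by
      rw [mul_comm a, mul_assoc]
      exact mul_le_mul_of_nonneg_right hKN' hax0
    have h3 : (N : ℝ) * (80 * a * x) ≤ N * N := mul_le_mul_of_nonneg_left hxN (Nat.cast_nonneg N)
    have h4 : (r : ℝ) * r ≤ N * N := by linarith
    exact Nat.mul_self_le_mul_self_iff.mp (by exact_mod_cast h4)
  -- the number of private tests of an item
  set t := ⌈5 / 2 * (a * x)⌉₊ with ht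
  have ht1 : 5 / 2 * (a * x) ≤ t := Nat.le_ceil _
  have ht2 : (t : ℝ) ≤ 5 / 2 * (a * x) + 1 := (Nat.ceil_lt_add_one (by linarith)).le
  -- the depth of the heap
  set d := Nat.log 2 N + 1 with hd
  have hd1 : 2 ^ d ≤ 2 * N := by
    rw [hd, pow_succ, mul_comm]
    exact Nat.mul_le_mul_left _ (Nat.pow_log_le_self 2 (by omega))
  have hd2 : N ≤ 2 ^ d := (Nat.lt_pow_succ_log_self (by norm_num) N).le
  have hd3 : (d : ℝ) ≤ 29 / 20 * x + 1 := by
    rw [hd]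
    push_cast
    linarith [natLog_two_le (by omega : N ≠ 0)]
  have hdN : d ≤ N := Nat.log_lt_self 2 (by omega)
  have htN : t ≤ N := by
    have : (t : ℝ) ≤ N := by linarith
    exact_mod_cast this
  have hL : ((t + 2 * d + 7 : ℕ) : ℝ) ≤ 6 * (a * x) := by push_cast; linarith
  -- the words are long enough
  set cF := 10 * (b + 2) with hcF
  have hword := card_lt_two_pow_mul_size (a := cF) (show 0 < N by omega)
  set w := (cF + 3) * Nat.size N with hw
  have hrr : r * r ≤ N * N := Nat.mul_le_mul hrN hrN
  have hcube : (N + 1) ^ 3 = N * N * N + 3 * (N * N) + 3 * N + 1 := by ring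
  have hNN : N * N ≤ N * N * N := Nat.le_mul_of_pos_right _ (by omega)
  have hNN' : 8000 * N ≤ N * N := Nat.mul_le_mul_right _ hN100'
  have hc3 : (N + 1) ^ 3 ≤ (cF + 1) * (N + 1) ^ 3 := Nat.le_mul_of_pos_left _ (by omega)
  have hw1 : 1 + r * r + 4 * r < 2 ^ w := by omega
  have hw2 : cF * (r * r) < 2 ^ w := by
    have h2 : cF * (r * r) ≤ cF * (N + 1) ^ 3 := Nat.mul_le_mul_left _ (by omega)
    have h3 : (cF + 1) * (N + 1) ^ 3 = cF * (N + 1) ^ 3 + (N + 1) ^ 3 := by ring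
    omega
  have hw3 : cF < 2 ^ w := by
    have h2 : cF ≤ cF * (r * r) := Nat.le_mul_of_pos_right _ (Nat.mul_pos (by omega) (by omega))
    omega
  have hw4 : 4 * N + d + (t + 2 * d + 7) < 2 ^ w := by omega
  -- there are enough tests
  have hM : 1 + r * r + 4 * r ≤ numTests C ζ b K N :=
    le_numTests ha1 hC hζ hb hx0 (by push_cast; exact hrT2)
  -- there is enough time
  have hT : 100 * (cF * (r * r)) + 13 ≤ stepBound (8000 * (10 * (b + 2)) * a + 13) ε K N := by
    refine le_stepBound (by positivity) hε hε' ?_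
    have hcF' : (cF : ℝ) = 10 * (b + 2) := by rw [hcF]; push_cast; ring
    have h2 : (r : ℝ) * r ≤ 80 * (a * K * x) := by linarith
    have h3 := mul_le_mul_of_nonneg_left h2 (by positivity : 0 ≤ 100 * (10 * ((b : ℝ) + 2)))
    push_cast
    rw [hcF']
    linarith
  have : Nonempty (Fin (r * r)) := ⟨⟨0, Nat.mul_pos (by omega) (by omega)⟩⟩
  refine ⟨matrixLaw _ N d r t, ?_, ?_⟩
  · intro A hA y
    obtain ⟨g, c, rfl⟩ := exists_of_mem_support_matrixLaw hA
    exact (decoder_haltsWithin (rowList_labelMatrix (by omega) hrN) (by omega) hw2 hw3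
      (by change N < _; omega)).mono (by omega)
  · intro S hS
    have hS' : (S.card : ℝ) ≤ K := by exact_mod_cast hS
    have hload : (S.card : ℝ) * (t + 2 * d) ≤ 3 / 20 * (r * r : ℕ) := by
      push_cast
      calc (S.card : ℝ) * (t + 2 * d) ≤ K * (6 * (a * x)) := by
            push_cast at hL
            exact mul_le_mul hS' (by linarith) (by positivity) (by linarith)
        _ = 3 / 20 * T₀ := by simp only [hT₀]; ring
        _ ≤ _ := by linarith
    refine (failureProb_matrixLaw_le h0 h1 hM hrN hw1 hw2 hw3 (by omega) hd1 hd2 hw4 hT S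
      hload).trans ?_
    have hKb : Real.exp (-(b * K)) ≤ (K : ℝ) ^ (-(b : ℝ)) := by
      rw [Real.rpow_def_of_pos (by linarith)]
      refine Real.exp_le_exp.mpr ?_
      have := Real.log_le_self (by linarith : (0 : ℝ) ≤ K)
      have := mul_le_mul_of_nonneg_right this (Nat.cast_nonneg (α := ℝ) b)
      linarith
    -- the noise hits more than half of the pool
    have e1 : Real.exp (-((r * r : ℕ) / 2500)) ≤ (K : ℝ) ^ (-(b : ℝ)) := by
      refine le_trans (Real.exp_le_exp.mpr ?_) hKb
      push_cast
      have h2 : (b : ℝ) * K ≤ x * (2 / 125) * K := mul_le_mul_of_nonneg_right hbx (by linarith)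
      have h3 : x * K ≤ a * K * x := by
        have := le_mul_of_one_le_left (mul_nonneg hx0 (Nat.cast_nonneg (α := ℝ) K)) ha1
        linarith
      simp only [hT₀] at hrT
      linarith
    -- the exploration is too long
    have e2 : Real.exp (S.card + 1 - (cF * (r * r) : ℕ) / (64 * (t + 2 * d + 7 : ℕ))) ≤
        (K : ℝ) ^ (-(b : ℝ)) := by
      refine le_trans (Real.exp_le_exp.mpr ?_) hKb
      have hLpos : (0 : ℝ) < (t + 2 * d + 7 : ℕ) := by positivity
      have h2 : ((b : ℝ) + 2) * K ≤ (cF * (r * r) : ℕ) / (64 * (t + 2 * d + 7 : ℕ)) := by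
        rw [le_div_iff₀ (by positivity)]
        have hb0 : (0 : ℝ) ≤ (b + 2) * K := by positivity
        calc ((b : ℝ) + 2) * K * (64 * (t + 2 * d + 7 : ℕ)) ≤
              ((b : ℝ) + 2) * K * (64 * (6 * (a * x))) := by gcongr
          _ ≤ ((b : ℝ) + 2) * 10 * T₀ := by
              simp only [hT₀]
              have : 0 ≤ ((b : ℝ) + 2) * K * (a * x) := mul_nonneg hb0 hax0
              linarith
          _ ≤ ((b : ℝ) + 2) * 10 * (r * r) := by gcongr
          _ = _ := by rw [hcF]; push_cast; ring
      linarith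
    -- an item outside `S` passes the final check
    have e3 : (N : ℝ) * (13 / 20) ^ t ≤ (N : ℝ) ^ (-η) := by
      have hN0 : (0 : ℝ) < N := by linarith
      have h2 : (13 / 20 : ℝ) ^ t ≤ Real.exp (-(a * x)) := by
        refine (pow_le_pow_left₀ (by norm_num) thirteen_twentieths_le t).trans ?_
        rw [← Real.exp_nat_mul]
        exact Real.exp_le_exp.mpr (by linarith)
      calc (N : ℝ) * (13 / 20) ^ t ≤ N * Real.exp (-(a * x)) := by gcongr
        _ = Real.exp x * Real.exp (-(a * x)) := by rw [hxdef, Real.exp_log hN0]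
        _ = (N : ℝ) ^ (-η) := by
            rw [← Real.exp_add, Real.rpow_def_of_pos hN0, ha]
            congr 1
            ring
    have e4 : 0 ≤ (N : ℝ) ^ (-η) := by positivity
    linarith

/-- A sequence of positive integers is `o(N ^ (1 - 2 * (1 + η) / C))` only if the exponent is
positive, and then it is at most `N`. -/
theorem le_of_isLittleO {C η : ℝ} (hC : 0 < C) (hη : 0 < η) {K : ℕ → ℕ}
    (hK : ∀ᶠ N : ℕ in atTop, 1 ≤ K N)
    (ho : (fun N : ℕ => (K N : ℝ)) =o[atTop] fun N : ℕ => (N : ℝ) ^ (1 - 2 * (1 + η) / C)) :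
    2 * (1 + η) ≤ C ∧ ∀ᶠ N : ℕ in atTop, K N ≤ N := by
  have h1 := ho.bound (by norm_num : (0 : ℝ) < 1 / 2)
  constructor
  · by_contra hlt
    push Not at hlt
    obtain ⟨N, hKN, hb, hN⟩ := (hK.and (h1.and (eventually_ge_atTop 1))).exists
    have hN1 : (1 : ℝ) ≤ N := by exact_mod_cast hN
    have hK1 : (1 : ℝ) ≤ K N := by exact_mod_cast hKN
    have he : 1 - 2 * (1 + η) / C ≤ 0 := by
      rw [sub_nonpos, le_div_iff₀ hC]
      linarith
    have h2 := Real.rpow_le_one_of_one_le_of_nonpos hN1 he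
    rw [Real.norm_of_nonneg (by positivity), Real.norm_of_nonneg (by positivity)] at hb
    linarith
  · filter_upwards [h1, eventually_ge_atTop 1] with N hb hN
    have hN1 : (1 : ℝ) ≤ N := by exact_mod_cast hN
    have he : 1 - 2 * (1 + η) / C ≤ 1 := by
      have : 0 ≤ 2 * (1 + η) / C := by positivity
      linarith
    have h2 := Real.rpow_le_rpow_of_exponent_le hN1 he
    rw [Real.rpow_one] at h2
    rw [Real.norm_of_nonneg (by positivity), Real.norm_of_nonneg (by positivity)] at hb
    have h3 : (K N : ℝ) ≤ N := by linarith
    exact_mod_cast h3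

end GroupTesting

theorem mainTheorem1 (C η : ℝ) (hC : 0 < C) (hη : 0 < η) (b : ℕ) (hb : 0 < b) :
    ∃ D : ℝ, 0 < D ∧
      ∀ ρ ζ ε : ℝ, 0 ≤ ρ → ρ ≤ 1 → 0 < ζ → 0 < ε → ε < 1 / 4 →
        ζ * ρ - ρ + 1 ≤ ζ * (Real.log (2 - 4 * ε)) ^ 2 →
        ∃ (P : GroupTesting.Program) (c : ℕ) (B : ℝ),
          ∀ K : ℕ → ℕ, (∀ᶠ N : ℕ in atTop, 1 ≤ K N) →
            (fun N : ℕ => (K N : ℝ)) =o[atTop] (fun N : ℕ => (N : ℝ) ^ (1 - 2 * (1 + η) / C)) →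
            ∀ᶠ N : ℕ in atTop,
              ∃ μ : PMF (GroupTesting.TestMatrix (GroupTesting.numTests C ζ b (K N) N) N),
                (∀ A ∈ μ.support, ∀ y,
                  GroupTesting.HaltsWithin (c * Nat.size N) P ⟨N, K N, _, A, y⟩
                    (GroupTesting.stepBound D ε (K N) N)) ∧
                ∀ S : Finset (Fin N), S.card ≤ K N →
                  GroupTesting.failureProb ρ (c * Nat.size N) P
                      (GroupTesting.stepBound D ε (K N) N) (K N) μ S
                    ≤ B * ((K N : ℝ) ^ (-(b : ℝ)) + (N : ℝ) ^ (-η)) := by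
  refine ⟨8000 * (10 * (b + 2)) * (1 + η) + 13, by positivity, ?_⟩
  intro ρ ζ ε h0 h1 hζ hε hε' hcond
  obtain ⟨hρ, hζ2⟩ := GroupTesting.density_and_rate h0 h1 hζ hε hε' hcond
  refine ⟨GroupTesting.decoder (10 * (b + 2)), 10 * (b + 2) + 3, 2, ?_⟩
  intro K hK ho
  obtain ⟨hC2, hKN⟩ := GroupTesting.le_of_isLittleO hC hη hK ho
  have hlog : Tendsto (fun N : ℕ => Real.log N) atTop atTop :=
    Real.tendsto_log_atTop.comp tendsto_natCast_atTop_atTop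
  have hlogN : ∀ᶠ N : ℕ in atTop, 80 * (1 + η) * Real.log N ≤ N := by
    have hpos : 0 < 1 / (80 * (1 + η)) := by positivity
    have := (Real.isLittleO_log_id_atTop.comp_tendsto tendsto_natCast_atTop_atTop).bound hpos
    filter_upwards [this] with N hN
    simp only [Function.comp_apply, id] at hN
    rw [Real.norm_of_nonneg (Nat.cast_nonneg N), one_div, inv_mul_eq_div,
      le_div_iff₀ (by positivity)] at hN
    have := Real.le_norm_self (Real.log N)
    nlinarith
  filter_upwards [hK, hKN, hlog.eventually_ge_atTop 100,
    (hlog.atTop_mul_const (by norm_num : (0 : ℝ) < 2 / 125)).eventually_ge_atTop (b : ℝ), hlogN]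
    with N g1 g2 g3 g4 g5
  exact GroupTesting.exists_scheme hη hC2 h0 hρ hζ2 hε hε' hb g1 g2 g3 g4 g5
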